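/- All graphs are finite, simple, loop-free and undirected, and may be empty. For a graph $G=(V,E)$ let $\lceil G\rceil=\langle V\cup E,\mathrm{inc}\rangle$ be its incidence structure, where $\mathrm{inc}\subseteq V\times E$ holds for $(v,e)$ if $v$ is an end of $e$. A class $\mathcal C$ of graphs is *MSO$_2$-orderable* if there is a monadic second-order formula $\varphi(x,y;Z_0,\dots,Z_{m-1})$ with set variables $Z_i$ such that for every non-empty $G\in\mathcal C$ there are sets $P_0,\dots,P_{m-1}\subseteq V\cup E$ for which $\{(a,b):\lceil G\rceil\models\varphi(a,b;\bar P)\}$ is a linear order on $V\cup E$. For $k\in\mathbb N$ let $\mathrm{Sep}(G,k)$ be the maximal number of connected components of $G-S$, where $S\subseteq V$ ranges over the sets of at most $k$ vertices. For $f:\mathbb N\to\mathbb N$, the class $\mathcal C$ has property $\mathsf{SEP}(f)$ if $\mathrm{Sep}(G,k)\le f(k)$ for all $G\in\mathcal C$ and all $k\in\mathbb N$; it has property $\mathsf{SEP}$ if it has $\mathsf{SEP}(f)$ for some $f:\mathbb N\to\mathbb N$. Let $\exp_0(n)=n$ and $\exp_{k+1}(n)=2^{\exp_k(n)}$; a function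 $f:\mathbb N\to\mathbb N$ is *elementary* if there is $k$ with $f(n)\le\exp_k(n)$ for all $n$. **Theorem.** Let $H$ be a graph and let $\mathcal C$ be a class of graphs none of which has $H$ as a minor. The following are equivalent: 1. $\mathcal C$ is MSO$_2$-orderable; 2. $\mathcal C$ has property $\mathsf{SEP}$; 3. $\mathcal C$ has property $\mathsf{SEP}(f)$ for some elementary function $f$. Furthermore, there is a computable function that maps $H$ to a number $k$ such that, for every class $\mathcal C$ omitting $H$ as a minor, (1) holds if and only if $\mathcal C$ has property $\mathsf{SEP}(f)$ for some $f$ with $f(n)\le\exp_k(n)$ for all sufficiently large $n$. Also, there is a computable function that maps $H$ and $d\in\mathbb N$ to a number $k$ such that every class $\mathcal C$ which omits $H$ as a minor and satisfies $\mathrm{Sep}(G,|V(H)|)\le d$ for all $G\in\mathcal C$ has property $\mathsf{SEP}(\exp_k)$. Finally, for all $p,d\in\mathbb N$, the class of all graphs $G$ with $\mathrm{Sep}(G,p)\le d$ that do not have the complete bipartite graph $K_{p,p}$ as a minor is MSO$_2$-orderable. -/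

import Mathlib

open CategoryTheory Filter

universe u v w

/-! ### Monadic second-order logic -/

/-- Monadic second-order formulas over the relation symbols of a language `L`, with `n` free
first-order variables and `m` free set variables. Quantifiers bind the last variable. -/
inductive MSOFormula (L : FirstOrder.Language.{u, v}) : ℕ → ℕ → Type v
  | falsum {n m : ℕ} : MSOFormula L n m
  | eq {n m : ℕ} (i j : Fin n) : MSOFormula L n m
  | rel {n m k : ℕ} (R : L.Relations k) (x : Fin k → Fin n) : MSOFormula L n m
  | mem {n m : ℕ} (i : Fin n) (X : Fin m) : MSOFormula L n m
  | imp {n m : ℕ} (φ ψ : MSOFormula L n m) : MSOFormula L n m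
  | all {n m : ℕ} (φ : MSOFormula L (n + 1) m) : MSOFormula L n m
  | allSet {n m : ℕ} (φ : MSOFormula L n (m + 1)) : MSOFormula L n m

/-- Satisfaction of a formula under values `a` of the first-order variables and `P` of the set
variables. -/
def MSOFormula.Realize {L : FirstOrder.Language.{u, v}} {A : Type w} [L.Structure A] :
    {n m : ℕ} → MSOFormula L n m → (Fin n → A) → (Fin m → Set A) → Prop
  | _, _, .falsum, _, _ => False
  | _, _, .eq i j, a, _ => a i = a j
  | _, _, .rel R x, a, _ => FirstOrder.Language.Structure.RelMap R (fun t => a (x t))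
  | _, _, .mem i X, a, P => a i ∈ P X
  | _, _, .imp φ ψ, a, P => φ.Realize a P → ψ.Realize a P
  | _, _, .all φ, a, P => ∀ b : A, φ.Realize (Fin.snoc a b) P
  | _, _, .allSet φ, a, P => ∀ Q : Set A, φ.Realize a (Fin.snoc P Q)

/-- `φ(x, y; Z₀, …, Z_{m-1})` defines an order on the class `K` of structures: in every non-empty
member, for some values of the parameters, it defines a linear order on the universe. -/
def DefinesOrder {L : FirstOrder.Language.{u, v}} {m : ℕ} (φ : MSOFormula L 2 m)
    (K : Set (Bundled.{w} L.Structure)) : Prop :=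
  ∀ A ∈ K, Nonempty A →
    ∃ P : Fin m → Set A, IsLinearOrder A (fun a b => φ.Realize ![a, b] P)

/-- A class of structures is MSO-orderable if a single formula defines an order on it. -/
def MSOOrderable {L : FirstOrder.Language.{u, v}} (K : Set (Bundled.{w} L.Structure)) : Prop :=
  ∃ (m : ℕ) (φ : MSOFormula L 2 m), DefinesOrder φ K

/-! ### Graphs and their incidence structures -/

/-- A finite simple undirected graph, possibly empty. -/
structure FinGraph where
  V : Type u
  finite : Finite V
  graph : SimpleGraph V

/-- The relation symbols of incidence structures: one binary symbol. -/
inductive IncRel : ℕ → Type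
  | inc : IncRel 2

/-- The language with the single binary relation symbol `inc`. -/
def incLanguage : FirstOrder.Language.{0, 0} := ⟨fun _ => Empty, IncRel⟩

/-- The incidence structure of a graph: its universe consists of the vertices and the edges, and
`inc (v, e)` holds if `v` is a vertex, `e` is an edge and `v` is an end of `e`. -/
@[reducible]
def incStructure {V : Type u} (G : SimpleGraph V) : incLanguage.Structure (V ⊕ G.edgeSet) where
  funMap := fun f => nomatch f
  RelMap := fun R x => match R with
    | .inc => ∃ (v : V) (e : G.edgeSet), x 0 = Sum.inl v ∧ x 1 = Sum.inr e ∧ v ∈ e.1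

/-- The class of incidence structures of the graphs of a class. -/
def incClass (C : Set FinGraph.{u}) : Set (Bundled.{u} incLanguage.Structure) :=
  {A | ∃ G ∈ C, A = ⟨G.V ⊕ G.graph.edgeSet, incStructure G.graph⟩}

/-- A class of graphs is MSO₂-orderable if its class of incidence structures is MSO-orderable. -/
def MSO2Orderable (C : Set FinGraph.{u}) : Prop :=
  MSOOrderable (incClass C)

/-! ### The property SEP -/

/-- `Sep(G, k)`: the maximal number of connected components of `G - S`, where `S` ranges over all
sets of at most `k` vertices. For finite `G` this is the supremum of a non-empty finite set. -/
noncomputable def sepNumber (G : FinGraph.{u}) (k : ℕ) : ℕ :=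
  sSup {n | ∃ S : Finset G.V, S.card ≤ k ∧
    n = Nat.card (G.graph.induce ((S : Set G.V)ᶜ)).ConnectedComponent}

/-- The property `SEP(f)`. -/
def SEPBound (f : ℕ → ℕ) (C : Set FinGraph.{u}) : Prop :=
  ∀ G ∈ C, ∀ k : ℕ, sepNumber G k ≤ f k

/-- The property `SEP`. -/
def SEP (C : Set FinGraph.{u}) : Prop :=
  ∃ f : ℕ → ℕ, SEPBound f C

/-- The iterated exponential: `expIter 0 n = n` and `expIter (k + 1) n = 2 ^ expIter k n`. -/
def expIter : ℕ → ℕ → ℕ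
  | 0, n => n
  | k + 1, n => 2 ^ expIter k n

/-- A function is elementary if it is bounded by some `expIter k`. -/
def IsElementary (f : ℕ → ℕ) : Prop :=
  ∃ k : ℕ, ∀ n : ℕ, f n ≤ expIter k n

/-! ### Minors -/

/-- `H` is a minor of `G`: there are pairwise disjoint connected non-empty sets of vertices of `G`,
one for each vertex of `H`, such that `G` has an edge between any two of them that belong to
adjacent vertices of `H`. -/
def IsGraphMinor {W : Type v} {V : Type u} (H : SimpleGraph W) (G : SimpleGraph V) : Prop :=
  ∃ B : W → Set V,
    (∀ x, (G.induce (B x)).Connected) ∧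
    (∀ x y, x ≠ y → Disjoint (B x) (B y)) ∧
    (∀ x y, H.Adj x y → ∃ a ∈ B x, ∃ b ∈ B y, G.Adj a b)

/-- No graph of the class `C` has `H` as a minor. -/
def OmitsMinor {W : Type v} (C : Set FinGraph.{u}) (H : SimpleGraph W) : Prop :=
  ∀ G ∈ C, ¬ IsGraphMinor H G.graph

/-! ### Finite graphs as inputs of computable functions -/

/-- A finite graph presented as the number of vertices together with a list of edges. -/
abbrev GraphCode := ℕ × List (ℕ × ℕ)

/-- The graph on `{0, …, n-1}` presented by a code. -/
def GraphCode.toGraph (c : GraphCode) : SimpleGraph (Fin c.1) :=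
  SimpleGraph.fromRel (fun i j => ((i : ℕ), (j : ℕ)) ∈ c.2)

/-! Orderability implies SEP by a composition argument. Delete at most `k` vertices and decompose
the incidence structure along the remaining components. Swapping two components whose local types
agree cannot be detected by a formula of the given quantifier rank (`PartedRel.Similar.realize_iff`,
a back-and-forth argument), so a formula that orders the structure needs many types for many
components. The number of types is bounded in terms of `k` and the formula alone.

For the converse, `H` is a minor of `K_{p,p}` with `p = |V(H)|`, so it suffices to exclude
`K_{p,p}`. The combinatorial core is `card_le_of_outerBoundary_eq`: at most `p + d` disjoint
connected sets share a boundary `N`. If `|N| ≥ p`, then `p` of the sets and `p` vertices of `N` form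
a `K_{p,p}` minor; if `|N| < p`, then `N` is a separator controlled by `Sep(G,p) ≤ d`. Summing over
the possible boundaries inside a separator gives `Sep(G,n) ≤ 2^n (p + d)`, whence all the elementary
bounds.

The same lemma, applied to subtrees of a normal spanning forest, shows that `p + d` colours separate
siblings whose subtrees have equal boundary. Boundaries of sibling subtrees lie in a common chain of
ancestors, so they can be compared lexicographically, with colours breaking ties. This orders
siblings, hence all vertices depth-first, hence the edges by their ends. The forest is encoded by
its edge set, the depth modulo 3 and the colours, from which everything is definable in monadic
second-order logic. -/

/-! ### Local types of the parts of a decomposed relation -/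

/-- A binary relation on `A` together with a partition of `A` into a separator (the elements
mapped to `none`) and parts indexed by `I`, such that distinct parts are unrelated. The elements
of the separator carry distinct labels. -/
structure PartedRel (A : Type*) (I : Type*) (Λ : Type*) where
  R : A → A → Prop
  part : A → Option I
  lab : A → Λ
  lab_inj : ∀ x y, part x = none → part y = none → lab x = lab y → x = y
  unrelated : ∀ x y i j, part x = some i → part y = some j → i ≠ j → ¬ R x y

/-- Atomic information on a tuple of elements and sets, as seen from one part. -/
abbrev LocalAtom (Λ : Type) (n m : ℕ) : Type :=
  (Fin n → Prop) × (Fin n → Fin n → Prop) × (Fin n → Fin n → Prop) ×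
    (Fin n → Λ → Prop) × (Fin n → Λ → Prop) × (Fin n → Fin m → Prop)

/-- Types of quantifier rank `q` in `n` elements and `m` sets, as seen from one part. -/
def LocalType (Λ : Type) : ℕ → ℕ → ℕ → Type
  | 0, n, m => LocalAtom Λ n m
  | q + 1, n, m => LocalAtom Λ n m × Set (LocalType Λ q (n + 1) m) × Set (LocalType Λ q n (m + 1))

/-- Finiteness is what permits the pigeonhole argument on parts; the number of types depends only on
the labels, the rank and the numbers of variables. -/
instance LocalType.instFinite (Λ : Type) [Finite Λ] (q n m : ℕ) : Finite (LocalType Λ q n m) := by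
  induction q generalizing n m with
  | zero => unfold LocalType; infer_instance
  | succ q ih =>
    unfold LocalType
    have := ih (n + 1) m
    have := ih n (m + 1)
    infer_instance

/-- The atomic part of a local type. -/
def LocalType.atom {Λ : Type} : {q n m : ℕ} → LocalType Λ q n m → LocalAtom Λ n m
  | 0, _, _, t => t
  | _ + 1, _, _, t => t.1

namespace PartedRel

variable {A : Type*} {I : Type*} {Λ : Type} (D : PartedRel A I Λ)

/-- The atomic information on a tuple as seen from the part `i`. -/
def localAtom (i : I) {n m : ℕ} (a : Fin n → A) (P : Fin m → Set A) : LocalAtom Λ n m :=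
  (fun t => D.part (a t) = some i,
   fun s t => D.part (a s) = some i ∧ D.part (a t) = some i ∧ a s = a t,
   fun s t => D.part (a s) = some i ∧ D.part (a t) = some i ∧ D.R (a s) (a t),
   -- Separator elements enter only through their labels, so that types seen from different parts,
   -- or in different structures, can be compared.
   fun t l => D.part (a t) = some i ∧ ∃ x, D.part x = none ∧ D.lab x = l ∧ D.R x (a t),
   fun t l => D.part (a t) = some i ∧ ∃ x, D.part x = none ∧ D.lab x = l ∧ D.R (a t) x,
   fun t X => D.part (a t) = some i ∧ a t ∈ P X)

/-- The local type of a tuple as seen from the part `i`. -/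
def localType (i : I) : (q : ℕ) → {n m : ℕ} → (Fin n → A) → (Fin m → Set A) → LocalType Λ q n m
  | 0, _, _, a, P => D.localAtom i a P
  | q + 1, _, _, a, P =>
    (D.localAtom i a P, {t | ∃ b, localType i q (Fin.snoc a b) P = t},
      {t | ∃ Q, localType i q a (Fin.snoc P Q) = t})

theorem atom_localType (i : I) (q : ℕ) {n m : ℕ} (a : Fin n → A) (P : Fin m → Set A) :
    (D.localType i q a P).atom = D.localAtom i a P := by
  cases q <;> rfl

/-- Tuples that agree within the part `i`. -/
def Agree (i : I) {n m : ℕ} (a a' : Fin n → A) (P P' : Fin m → Set A) : Prop :=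
  (∀ t, a t = a' t ∨ (D.part (a t) ≠ some i ∧ D.part (a' t) ≠ some i)) ∧
    ∀ X x, D.part x = some i → (x ∈ P X ↔ x ∈ P' X)

variable {D}

theorem Agree.localAtom_eq {i : I} {n m : ℕ} {a a' : Fin n → A} {P P' : Fin m → Set A}
    (h : D.Agree i a a' P P') : D.localAtom i a P = D.localAtom i a' P' := by
  obtain ⟨h, hP⟩ := h
  have h1 : ∀ t, D.part (a t) = some i ↔ D.part (a' t) = some i := by
    intro t
    rcases h t with e | ⟨e, e'⟩
    · rw [e]
    · simp [e, e']
  have h2 : ∀ t, D.part (a t) = some i → a t = a' t := by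
    intro t ht
    rcases h t with e | ⟨e, e'⟩
    · exact e
    · exact absurd ht e
  unfold localAtom
  refine Prod.ext ?_ (Prod.ext ?_ (Prod.ext ?_ (Prod.ext ?_ (Prod.ext ?_ ?_)))) <;>
    dsimp only <;> funext s
  · exact propext (h1 s)
  · funext t; rw [← h1, ← h1]
    exact propext (and_congr_right fun hs => and_congr_right fun ht => by rw [h2 s hs, h2 t ht])
  · funext t; rw [← h1, ← h1]
    exact propext (and_congr_right fun hs => and_congr_right fun ht => by rw [h2 s hs, h2 t ht])
  · funext t; rw [← h1]
    exact propext (and_congr_right fun hs => by rw [h2 s hs])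
  · funext t; rw [← h1]
    exact propext (and_congr_right fun hs => by rw [h2 s hs])
  · funext t; rw [← h1]
    exact propext (and_congr_right fun hs => by rw [hP _ _ hs, h2 s hs])

theorem Agree.snoc {i : I} {n m : ℕ} {a a' : Fin n → A} {P P' : Fin m → Set A}
    (h : D.Agree i a a' P P') {b b' : A}
    (hb : b = b' ∨ (D.part b ≠ some i ∧ D.part b' ≠ some i)) :
    D.Agree i (Fin.snoc a b : Fin (n + 1) → A) (Fin.snoc a' b') P P' := by
  refine ⟨fun t => ?_, h.2⟩
  induction t using Fin.lastCases with
  | last => simpa using hb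
  | cast t => simpa using h.1 t

theorem Agree.snocSet {i : I} {n m : ℕ} {a a' : Fin n → A} {P P' : Fin m → Set A}
    (h : D.Agree i a a' P P') {Q Q' : Set A}
    (hQ : ∀ x, D.part x = some i → (x ∈ Q ↔ x ∈ Q')) :
    D.Agree i a a' (Fin.snoc P Q : Fin (m + 1) → Set A) (Fin.snoc P' Q') := by
  refine ⟨h.1, fun X => ?_⟩
  induction X using Fin.lastCases with
  | last => simpa using hQ
  | cast t => simpa using h.2 t

/-- From the part `i`, an element elsewhere is visible only as being elsewhere, so it can be
exchanged for any other outside element. -/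
theorem Agree.localType_eq {i : I} {q n m : ℕ} {a a' : Fin n → A} {P P' : Fin m → Set A}
    (h : D.Agree i a a' P P') : D.localType i q a P = D.localType i q a' P' := by
  induction q generalizing n m with
  | zero => exact h.localAtom_eq
  | succ q ih =>
    unfold localType
    refine Prod.ext h.localAtom_eq (Prod.ext ?_ ?_)
    · ext t
      exact exists_congr fun b => by rw [ih (h.snoc (Or.inl rfl))]
    · ext t
      exact exists_congr fun Q => by rw [ih (h.snocSet fun _ _ => Iff.rfl)]

theorem Agree.refl {i : I} {n m : ℕ} (a : Fin n → A) (P : Fin m → Set A) :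
    D.Agree i a a P P :=
  ⟨fun _ => Or.inl rfl, fun _ _ _ => Iff.rfl⟩

variable (D) in
/-- Two tuples agree on the separator and have equal local types up to a permutation of the
parts. -/
structure Similar (q : ℕ) (π : Equiv.Perm I) {n m : ℕ} (a a' : Fin n → A)
    (P P' : Fin m → Set A) : Prop where
  none_iff : ∀ t, D.part (a t) = none ↔ D.part (a' t) = none
  eq_of_none : ∀ t, D.part (a t) = none → a t = a' t
  mem_iff : ∀ X x, D.part x = none → (x ∈ P X ↔ x ∈ P' X)
  type_eq : ∀ i, D.localType i q a P = D.localType (π i) q a' P'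

theorem Similar.symm {q : ℕ} {π : Equiv.Perm I} {n m : ℕ} {a a' : Fin n → A}
    {P P' : Fin m → Set A} (h : D.Similar q π a a' P P') : D.Similar q π.symm a' a P' P where
  none_iff t := (h.none_iff t).symm
  eq_of_none t ht := (h.eq_of_none t ((h.none_iff t).2 ht)).symm
  mem_iff X x hx := (h.mem_iff X x hx).symm
  type_eq i := by rw [h.type_eq (π.symm i), Equiv.apply_symm_apply]

theorem Similar.atom_eq {q : ℕ} {π : Equiv.Perm I} {n m : ℕ} {a a' : Fin n → A}
    {P P' : Fin m → Set A} (h : D.Similar q π a a' P P') (i : I) :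
    D.localAtom i a P = D.localAtom (π i) a' P' := by
  have := congrArg LocalType.atom (h.type_eq i)
  rwa [atom_localType, atom_localType] at this

/-- The forth step for elements. A separator element answers itself; an element of the part `i` is
answered inside `π i`, using equality of the types there. In every other part the answer is
invisible, so `Agree` applies. -/
theorem Similar.exists_snoc {q : ℕ} {π : Equiv.Perm I} {n m : ℕ} {a a' : Fin n → A}
    {P P' : Fin m → Set A} (h : D.Similar (q + 1) π a a' P P') (b : A) :
    ∃ b', D.Similar q π (Fin.snoc a b : Fin (n + 1) → A) (Fin.snoc a' b') P P' := by
  have key : ∀ i, ∃ b', D.localType i q (Fin.snoc a b : Fin (n + 1) → A) P =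
      D.localType (π i) q (Fin.snoc a' b' : Fin (n + 1) → A) P' ∧
      (D.part b = some i ↔ D.part b' = some (π i)) := by
    intro i
    have h1 := congrArg (fun t => t.2.1) (h.type_eq i)
    have h2 : D.localType i q (Fin.snoc a b : Fin (n + 1) → A) P ∈
        {t | ∃ b', D.localType (π i) q (Fin.snoc a' b' : Fin (n + 1) → A) P' = t} :=
      (Set.ext_iff.1 h1 _).1 ⟨b, rfl⟩
    obtain ⟨b', hb'⟩ := h2
    refine ⟨b', hb'.symm, ?_⟩
    have h3 := congrArg LocalType.atom hb'
    rw [atom_localType, atom_localType] at h3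
    have h4 := congrFun (congrArg (fun t => t.1) h3) (Fin.last n)
    simpa [localAtom] using h4.symm
  cases hb : D.part b with
  | none =>
    refine ⟨b, ?_, ?_, h.mem_iff, ?_⟩
    · intro t
      induction t using Fin.lastCases with
      | last => simp
      | cast t => simpa using h.none_iff t
    · intro t
      induction t using Fin.lastCases with
      | last => simp
      | cast t => simpa using h.eq_of_none t
    · intro i
      obtain ⟨b', e, hb'⟩ := key i
      rw [e]
      refine Agree.localType_eq ((Agree.refl _ _).snoc (Or.inr ⟨?_, by simp [hb]⟩))
      rw [Ne, ← hb', hb]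
      simp
  | some i =>
    obtain ⟨b', e, hb'⟩ := key i
    have hb'' := hb'.1 hb
    refine ⟨b', ?_, ?_, h.mem_iff, ?_⟩
    · intro t
      induction t using Fin.lastCases with
      | last => simp [hb, hb'']
      | cast t => simpa using h.none_iff t
    · intro t
      induction t using Fin.lastCases with
      | last => simp [hb]
      | cast t => simpa using h.eq_of_none t
    · intro j
      by_cases hj : j = i
      · subst hj; exact e
      · obtain ⟨c, e, hc⟩ := key j
        rw [e]
        refine Agree.localType_eq ((Agree.refl _ _).snoc (Or.inr ⟨?_, ?_⟩))
        · rw [Ne, ← hc, hb]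
          simpa using fun h => hj h.symm
        · rw [hb'']
          simpa using fun h => hj h.symm

/-- The forth step for sets. Every part supplies its own answer, and these are glued, which is
possible because each type depends only on the trace of the set on its part. -/
theorem Similar.exists_snocSet {q : ℕ} {π : Equiv.Perm I} {n m : ℕ} {a a' : Fin n → A}
    {P P' : Fin m → Set A} (h : D.Similar (q + 1) π a a' P P') (Q : Set A) :
    ∃ Q', D.Similar q π a a' (Fin.snoc P Q : Fin (m + 1) → Set A) (Fin.snoc P' Q') := by
  have key : ∀ i, ∃ Q', D.localType i q a (Fin.snoc P Q : Fin (m + 1) → Set A) =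
      D.localType (π i) q a' (Fin.snoc P' Q' : Fin (m + 1) → Set A) := by
    intro i
    have h1 := congrArg (fun t => t.2.2) (h.type_eq i)
    have h2 : D.localType i q a (Fin.snoc P Q : Fin (m + 1) → Set A) ∈
        {t | ∃ Q', D.localType (π i) q a' (Fin.snoc P' Q' : Fin (m + 1) → Set A) = t} :=
      (Set.ext_iff.1 h1 _).1 ⟨Q, rfl⟩
    obtain ⟨Q', hQ'⟩ := h2
    exact ⟨Q', hQ'.symm⟩
  choose Q' hQ' using key
  refine ⟨{x | (D.part x = none ∧ x ∈ Q) ∨ ∃ i, D.part x = some (π i) ∧ x ∈ Q' i},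
    h.none_iff, h.eq_of_none, ?_, ?_⟩
  · intro X x hx
    induction X using Fin.lastCases with
    | last => simp [hx]
    | cast t => simpa using h.mem_iff t x hx
  · intro i
    rw [hQ' i]
    refine Agree.localType_eq ((Agree.refl _ _).snocSet ?_)
    intro x hx
    simp [hx]

end PartedRel

/-! ### Invariance of formulas under similarity, and the bound on the number of parts. -/

/-- Quantifier rank. -/
def MSOFormula.rank {L : FirstOrder.Language.{u, v}} : {n m : ℕ} → MSOFormula L n m → ℕ
  | _, _, .falsum => 0
  | _, _, .eq _ _ => 0
  | _, _, .rel _ _ => 0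
  | _, _, .mem _ _ => 0
  | _, _, .imp φ ψ => max φ.rank ψ.rank
  | _, _, .all φ => φ.rank + 1
  | _, _, .allSet φ => φ.rank + 1

/-- Incidence formulas do not distinguish similar tuples. -/
theorem PartedRel.Similar.realize_iff {A : Type w} [incLanguage.Structure A] {I : Type*} {Λ : Type}
    {D : PartedRel A I Λ}
    (hD : ∀ x : Fin 2 → A, FirstOrder.Language.Structure.RelMap (L := incLanguage) IncRel.inc x ↔
      D.R (x 0) (x 1))
    {n m : ℕ} (φ : MSOFormula incLanguage n m) {q : ℕ} (hq : φ.rank ≤ q) {π : Equiv.Perm I}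
    {a a' : Fin n → A} {P P' : Fin m → Set A} (h : D.Similar q π a a' P P') :
    φ.Realize a P ↔ φ.Realize a' P' := by
  have hpart : ∀ {q : ℕ} {π : Equiv.Perm I} {n m : ℕ} {a a' : Fin n → A} {P P' : Fin m → Set A},
      D.Similar q π a a' P P' → ∀ t i, D.part (a t) = some i → D.part (a' t) = some (π i) := by
    intro q π n m a a' P P' h t i hi
    have := congrFun (congrArg (fun t => t.1) (h.atom_eq i)) t
    exact (iff_of_eq this).1 hi
  induction φ generalizing q π with
  | falsum => rfl
  | eq s t =>
    suffices H : ∀ {q : ℕ} {π : Equiv.Perm I} {a a' : Fin _ → A} {P P' : Fin _ → Set A},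
        D.Similar q π a a' P P' → a s = a t → a' s = a' t from ⟨H h, H h.symm⟩
    intro q π a a' P P' h e
    cases hs : D.part (a s) with
    | none => rw [← h.eq_of_none s hs, ← h.eq_of_none t (e ▸ hs), e]
    | some i =>
      have := congrFun (congrFun (congrArg (fun t => t.2.1) (h.atom_eq i)) s) t
      exact ((iff_of_eq this).1 ⟨hs, e ▸ hs, e⟩).2.2
  | @rel n m k S x =>
    cases S with
    | inc =>
    suffices H : ∀ {q : ℕ} {π : Equiv.Perm I} {a a' : Fin _ → A} {P P' : Fin _ → Set A},
        D.Similar q π a a' P P' → D.R (a (x 0)) (a (x 1)) → D.R (a' (x 0)) (a' (x 1)) by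
      unfold MSOFormula.Realize
      erw [hD, hD]
      exact ⟨H h, H h.symm⟩
    intro q π a a' P P' h e
    cases hs : D.part (a (x 0)) with
    | none =>
      cases ht : D.part (a (x 1)) with
      | none => rwa [← h.eq_of_none _ hs, ← h.eq_of_none _ ht]
      | some i =>
        have := congrFun (congrFun (congrArg (fun t => t.2.2.2.1) (h.atom_eq i)) (x 1))
          (D.lab (a (x 0)))
        obtain ⟨-, y, hy, hl, hr⟩ := (iff_of_eq this).1 ⟨ht, _, hs, rfl, e⟩
        rwa [← h.eq_of_none _ hs, ← D.lab_inj _ _ hy hs hl]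
    | some i =>
      cases ht : D.part (a (x 1)) with
      | none =>
        have := congrFun (congrFun (congrArg (fun t => t.2.2.2.2.1) (h.atom_eq i)) (x 0))
          (D.lab (a (x 1)))
        obtain ⟨-, y, hy, hl, hr⟩ := (iff_of_eq this).1 ⟨hs, _, ht, rfl, e⟩
        rwa [← h.eq_of_none _ ht, ← D.lab_inj _ _ hy ht hl]
      | some j =>
        by_cases hij : i = j
        · subst hij
          have := congrFun (congrFun (congrArg (fun t => t.2.2.1) (h.atom_eq i)) (x 0)) (x 1)
          exact ((iff_of_eq this).1 ⟨hs, ht, e⟩).2.2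
        · exact absurd e (D.unrelated _ _ i j hs ht hij)
  | mem t X =>
    suffices H : ∀ {q : ℕ} {π : Equiv.Perm I} {a a' : Fin _ → A} {P P' : Fin _ → Set A},
        D.Similar q π a a' P P' → a t ∈ P X → a' t ∈ P' X from ⟨H h, H h.symm⟩
    intro q π a a' P P' h e
    cases hs : D.part (a t) with
    | none => rwa [← h.eq_of_none t hs, ← h.mem_iff X _ hs]
    | some i =>
      have := congrFun (congrFun (congrArg (fun t => t.2.2.2.2.2) (h.atom_eq i)) t) X
      exact ((iff_of_eq this).1 ⟨hs, e⟩).2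
  | imp φ ψ ihφ ihψ =>
    have := max_le_iff.1 hq
    exact imp_congr (ihφ this.1 h) (ihψ this.2 h)
  | all φ ih =>
    obtain ⟨q, rfl⟩ : ∃ r, q = r + 1 := ⟨q - 1, by simp only [MSOFormula.rank] at hq; omega⟩
    have hq' : φ.rank ≤ q := by simpa [MSOFormula.rank] using hq
    constructor
    · intro H b
      obtain ⟨b', hb'⟩ := h.symm.exists_snoc b
      exact (ih hq' hb').2 (H b')
    · intro H b
      obtain ⟨b', hb'⟩ := h.exists_snoc b
      exact (ih hq' hb').2 (H b')
  | allSet φ ih =>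
    obtain ⟨q, rfl⟩ : ∃ r, q = r + 1 := ⟨q - 1, by simp only [MSOFormula.rank] at hq; omega⟩
    have hq' : φ.rank ≤ q := by simpa [MSOFormula.rank] using hq
    constructor
    · intro H b
      obtain ⟨b', hb'⟩ := h.symm.exists_snocSet b
      exact (ih hq' hb').2 (H b')
    · intro H b
      obtain ⟨b', hb'⟩ := h.exists_snocSet b
      exact (ih hq' hb').2 (H b')

/-- A formula that defines a linear order bounds the number of nonempty parts. -/
theorem PartedRel.card_le_of_isLinearOrder {A : Type w} [incLanguage.Structure A] {I : Type*}
    [Finite I] {Λ : Type} [Finite Λ] (D : PartedRel A I Λ)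
    (hD : ∀ x : Fin 2 → A, FirstOrder.Language.Structure.RelMap (L := incLanguage) IncRel.inc x ↔
      D.R (x 0) (x 1))
    (hne : ∀ i, ∃ x, D.part x = some i)
    {m : ℕ} (φ : MSOFormula incLanguage 2 m) (P : Fin m → Set A)
    (hP : IsLinearOrder A (fun a b => φ.Realize ![a, b] P)) :
    Nat.card I ≤ Nat.card (LocalType Λ φ.rank 2 m × LocalType Λ φ.rank 2 m) + 1 := by
  classical
  choose x hx using hne
  by_contra! hlt
  -- The summand 1 in the bound guarantees at least two parts.
  have : Nontrivial I := Finite.one_lt_card_iff_nontrivial.1 (by omega)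
  choose y hy using fun i : I => exists_ne i
  let τ : I → LocalType Λ φ.rank 2 m × LocalType Λ φ.rank 2 m := fun i =>
    (D.localType i φ.rank ![x i, x (y i)] P, D.localType i φ.rank ![x (y i), x i] P)
  have hτ : ¬ Function.Injective τ := fun h => by
    have := Nat.card_le_card_of_injective τ h
    omega
  obtain ⟨i, j, hτ, hij⟩ := Function.not_injective_iff.1 hτ
  have hτ1 : D.localType i φ.rank ![x i, x (y i)] P = D.localType j φ.rank ![x j, x (y j)] P :=
    congrArg Prod.fst hτ
  have hτ2 : D.localType i φ.rank ![x (y i), x i] P = D.localType j φ.rank ![x (y j), x j] P :=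
    congrArg Prod.snd hτ
  have hag : ∀ (k : I) (b c b' c' : A),
      (b = b' ∨ (D.part b ≠ some k ∧ D.part b' ≠ some k)) →
      (c = c' ∨ (D.part c ≠ some k ∧ D.part c' ≠ some k)) →
      D.localType k φ.rank ![b, c] P = D.localType k φ.rank ![b', c'] P := by
    intro k b c b' c' hb hc
    refine Agree.localType_eq ⟨fun t => ?_, fun _ _ _ => Iff.rfl⟩
    fin_cases t
    · exact hb
    · exact hc
  have hne : ∀ k l : I, l ≠ k → D.part (x l) ≠ some k := fun k l h => by
    rw [hx]; simpa using h
  -- Swapping the parts `i` and `j` exchanges the two pairs; both components of `τ` are needed, one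
  -- for each position in the pair. The formula then holds in both directions, against antisymmetry.
  have hsim : D.Similar φ.rank (Equiv.swap i j) ![x i, x j] ![x j, x i] P P := by
    refine ⟨fun t => ?_, fun t => ?_, fun _ _ _ => Iff.rfl, fun k => ?_⟩
    · fin_cases t <;> simp [hx]
    · fin_cases t <;> simp [hx]
    · by_cases hki : k = i
      · subst hki
        rw [Equiv.swap_apply_left,
          hag k _ _ (x k) (x (y k)) (Or.inl rfl) (Or.inr ⟨hne _ _ hij.symm, hne _ _ (hy _)⟩), hτ1]
        exact hag _ _ _ _ _ (Or.inl rfl) (Or.inr ⟨hne _ _ (hy _), hne _ _ hij⟩)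
      · by_cases hkj : k = j
        · subst hkj
          rw [Equiv.swap_apply_right,
            hag k _ _ (x (y k)) (x k) (Or.inr ⟨hne _ _ hij, hne _ _ (hy _)⟩) (Or.inl rfl), ← hτ2]
          exact hag _ _ _ _ _ (Or.inr ⟨hne _ _ (hy _), hne _ _ hij.symm⟩) (Or.inl rfl)
        · rw [Equiv.swap_apply_of_ne_of_ne hki hkj]
          exact hag _ _ _ _ _ (Or.inr ⟨hne _ _ (Ne.symm hki), hne _ _ (Ne.symm hkj)⟩)
            (Or.inr ⟨hne _ _ (Ne.symm hkj), hne _ _ (Ne.symm hki)⟩)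
  have hiff := hsim.realize_iff hD φ le_rfl
  have hboth : φ.Realize ![x i, x j] P ∧ φ.Realize ![x j, x i] P := by
    rcases hP.total (x i) (x j) with h | h
    · exact ⟨h, hiff.1 h⟩
    · exact ⟨hiff.2 h, h⟩
  have heq : x i = x j := hP.antisymm _ _ hboth.1 hboth.2
  exact hij (Option.some_injective _ (by rw [← hx i, ← hx j, heq]))

/-! ### Orderable classes have property SEP -/

section

variable {V : Type u} (G : SimpleGraph V) (S : Finset V)

/-- The ends of an element of the incidence structure; a vertex is its own only end. -/
def incEnds : V ⊕ G.edgeSet → Set V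
  | .inl v => {v}
  | .inr e => {v | v ∈ e.1}

variable {G}

theorem adj_of_mem_incEnds {x : V ⊕ G.edgeSet} {v w : V} (hv : v ∈ incEnds G x)
    (hw : w ∈ incEnds G x) (h : v ≠ w) : G.Adj v w := by
  rcases x with x | ⟨e, he⟩
  · exact absurd (hv.trans hw.symm) h
  · have : e = s(v, w) := (Sym2.mem_and_mem_iff h).1 ⟨hv, hw⟩
    rwa [this] at he

theorem incEnds_injective {x y : V ⊕ G.edgeSet} (h : incEnds G x = incEnds G y)
    (h' : x.isLeft = y.isLeft) : x = y := by
  rcases x with x | x <;> rcases y with y | y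
  · exact congrArg _ (Set.singleton_injective h)
  · simp at h'
  · simp at h'
  · exact congrArg _ (Subtype.ext (Sym2.ext fun v => Set.ext_iff.1 h v))

open Classical in
variable (G) in
/-- The component of `G - S` to which an element of the incidence structure belongs. -/
noncomputable def incPart (x : V ⊕ G.edgeSet) :
    Option (G.induce ((S : Set V)ᶜ)).ConnectedComponent :=
  if h : ∃ v, v ∈ incEnds G x ∧ v ∈ ((S : Set V)ᶜ) then
    some ((G.induce ((S : Set V)ᶜ)).connectedComponentMk ⟨h.choose, h.choose_spec.2⟩)
  else none

/-- The choice of the end does not matter, since two ends of an edge that avoid `S` are adjacent in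
`G - S`. -/
theorem incPart_eq {x : V ⊕ G.edgeSet} {v : V} (hv : v ∈ incEnds G x) (hS : v ∈ ((S : Set V)ᶜ)) :
    incPart G S x = some ((G.induce ((S : Set V)ᶜ)).connectedComponentMk ⟨v, hS⟩) := by
  have h : ∃ v, v ∈ incEnds G x ∧ v ∈ ((S : Set V)ᶜ) := ⟨v, hv, hS⟩
  rw [incPart, dif_pos h]
  congr 1
  by_cases e : h.choose = v
  · congr
  · refine SimpleGraph.ConnectedComponent.sound (SimpleGraph.Adj.reachable ?_)
    exact adj_of_mem_incEnds (G := G) h.choose_spec.1 hv e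

theorem incPart_eq_none {x : V ⊕ G.edgeSet} (h : incPart G S x = none) {v : V}
    (hv : v ∈ incEnds G x) : v ∈ S := by
  by_contra hS
  rw [incPart_eq S hv (by simpa using hS)] at h
  simp at h

variable (G) in
/-- The incidence structure, decomposed along the components of `G - S`. -/
noncomputable def incPartedRel {k : ℕ} (ι : S ↪ Fin k) :
    PartedRel (V ⊕ G.edgeSet) (G.induce ((S : Set V)ᶜ)).ConnectedComponent
      (Bool × Set (Fin k)) where
  R x y := ∃ (v : V) (e : G.edgeSet), x = Sum.inl v ∧ y = Sum.inr e ∧ v ∈ e.1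
  part := incPart G S
  -- The ends of a separator element all lie in `S`, so its kind and the indices of its ends
  -- determine it. The label set depends on `k` only, not on the graph.
  lab x := (x.isLeft, {t | ∃ s : S, s.1 ∈ incEnds G x ∧ ι s = t})
  lab_inj x y hx hy h := by
    have h2 := Set.ext_iff.1 (congrArg Prod.snd h)
    refine incEnds_injective (Set.ext fun v => ⟨fun hv => ?_, fun hv => ?_⟩) (congrArg Prod.fst h)
    · obtain ⟨s, hs, e⟩ := (h2 (ι ⟨v, incPart_eq_none S hx hv⟩)).1 ⟨_, hv, rfl⟩
      rwa [ι.injective e] at hs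
    · obtain ⟨s, hs, e⟩ := (h2 (ι ⟨v, incPart_eq_none S hy hv⟩)).2 ⟨_, hv, rfl⟩
      rwa [ι.injective e] at hs
  unrelated := by
    rintro _ _ i j hx hy hij ⟨v, e, rfl, rfl, hv⟩
    by_cases hS : v ∈ ((S : Set V)ᶜ)
    · rw [incPart_eq S (Set.mem_singleton v) hS] at hx
      rw [incPart_eq S (x := Sum.inr e) hv hS, hx] at hy
      exact hij (Option.some_injective _ hy)
    · rw [incPart, dif_neg] at hx
      · simp at hx
      · rintro ⟨w, rfl, hw⟩
        exact hS hw

end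

/-! ### The supremum defining `Sep`, and the implication from orderability to SEP. -/

/-- The numbers over which `sepNumber` takes the supremum are bounded. -/
theorem bddAbove_sepNumber (G : FinGraph.{u}) (k : ℕ) :
    BddAbove {n | ∃ S : Finset G.V, S.card ≤ k ∧
      n = Nat.card (G.graph.induce ((S : Set G.V)ᶜ)).ConnectedComponent} := by
  have := G.finite
  refine ⟨Nat.card G.V, ?_⟩
  rintro n ⟨S, -, rfl⟩
  refine (Nat.card_le_card_of_surjective
    (G.graph.induce ((S : Set G.V)ᶜ)).connectedComponentMk Quot.mk_surjective).trans ?_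
  exact Nat.card_le_card_of_injective Subtype.val Subtype.val_injective

theorem sepNumber_le {G : FinGraph.{u}} {k d : ℕ}
    (h : ∀ S : Finset G.V, S.card ≤ k →
      Nat.card (G.graph.induce ((S : Set G.V)ᶜ)).ConnectedComponent ≤ d) :
    sepNumber G k ≤ d := by
  refine csSup_le ⟨_, ∅, by simp, rfl⟩ ?_
  rintro n ⟨S, hS, rfl⟩
  exact h S hS

theorem card_connectedComponent_le_sepNumber (G : FinGraph.{u}) {k : ℕ} (S : Finset G.V)
    (hS : S.card ≤ k) :
    Nat.card (G.graph.induce ((S : Set G.V)ᶜ)).ConnectedComponent ≤ sepNumber G k :=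
  le_csSup (bddAbove_sepNumber G k) ⟨S, hS, rfl⟩

/-- MSO₂-orderable classes have property SEP. -/
theorem MSO2Orderable.sep {C : Set FinGraph.{u}} (h : MSO2Orderable C) : SEP C := by
  obtain ⟨m, φ, hφ⟩ := h
  refine ⟨fun k => Nat.card (LocalType (Bool × Set (Fin k)) φ.rank 2 m ×
    LocalType (Bool × Set (Fin k)) φ.rank 2 m) + 1, fun G hG k => sepNumber_le fun S hS => ?_⟩
  have := G.finite
  -- The formula says nothing about the empty graph, which has no components.
  rcases isEmpty_or_nonempty G.V with hV | hV
  · have : IsEmpty (G.graph.induce ((S : Set G.V)ᶜ)).ConnectedComponent :=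
      ⟨fun c => c.ind fun v => hV.elim v.1⟩
    simp
  let := incStructure G.graph
  obtain ⟨P, hP⟩ := hφ _ ⟨G, hG, rfl⟩ ⟨Sum.inl hV.some⟩
  have ι : Nonempty (S ↪ Fin k) :=
    Function.Embedding.nonempty_of_card_le (by simpa using hS)
  refine (incPartedRel G.graph S ι.some).card_le_of_isLinearOrder (fun x => Iff.rfl) ?_ φ P hP
  intro c
  induction c using SimpleGraph.ConnectedComponent.ind with
  | h v => exact ⟨Sum.inl v.1, incPart_eq S rfl v.2⟩

/-! ### Connected sets with a common boundary -/

/-- The vertices outside of `D` with a neighbour in `D`. -/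
def outerBoundary {V : Type u} (G : SimpleGraph V) (D : Set V) : Set V :=
  {a | a ∉ D ∧ ∃ w ∈ D, G.Adj w a}

theorem connected_induce_singleton {V : Type u} (G : SimpleGraph V) (a : V) :
    (G.induce {a}).Connected :=
  SimpleGraph.Connected.mk (SimpleGraph.Preconnected.of_subsingleton)

/-- In a graph without `K_{p,p}` minor, few disjoint connected sets have the same boundary, or
removing this boundary leaves many components. -/
theorem card_le_of_outerBoundary_eq {G : FinGraph.{u}} {p d : ℕ} (hsep : sepNumber G p ≤ d)
    (hG : ¬ IsGraphMinor (completeBipartiteGraph (Fin p) (Fin p)) G.graph)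
    {ι : Type*} [Finite ι] (D : ι → Set G.V) (hconn : ∀ i, (G.graph.induce (D i)).Connected)
    (hdisj : ∀ i j, i ≠ j → Disjoint (D i) (D j)) (N : Set G.V)
    (hN : ∀ i, outerBoundary G.graph (D i) = N) : Nat.card ι ≤ p + d := by
  have := G.finite
  have hND : ∀ i a, a ∈ N → a ∉ D i := fun i a ha => by
    rw [← hN i] at ha
    exact ha.1
  by_contra! hlt
  -- A large boundary gives a `K_{p,p}` minor with singletons of `N` on one side; a small one is a
  -- separator, and each `D i` is closed under adjacency outside it, so the `D i` meet distinct
  -- components.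
  rcases le_or_gt p N.ncard with hp | hp
  · apply hG
    have := Fintype.ofFinite ι
    have := Fintype.ofFinite N
    obtain ⟨g⟩ : Nonempty (Fin p ↪ ι) := Function.Embedding.nonempty_of_card_le (by
      rw [Fintype.card_fin, ← Nat.card_eq_fintype_card]; omega)
    obtain ⟨f⟩ : Nonempty (Fin p ↪ N) := Function.Embedding.nonempty_of_card_le (by
      rw [Fintype.card_fin, ← Nat.card_eq_fintype_card, Nat.card_coe_set_eq]; exact hp)
    have hadj : ∀ i j, ∃ a ∈ D (g i), ∃ b ∈ ({(f j).1} : Set G.V), G.graph.Adj a b := by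
      intro i j
      obtain ⟨-, w, hw, h⟩ := (Set.ext_iff.1 (hN (g i)) _).2 (f j).2
      exact ⟨w, hw, _, rfl, h⟩
    refine ⟨Sum.elim (fun i => D (g i)) (fun j => {(f j).1}), ?_, ?_, ?_⟩
    · rintro (i | j)
      · exact hconn _
      · exact connected_induce_singleton _ _
    · rintro (i | i) (j | j) h
      · exact hdisj _ _ fun e => h (congrArg _ (g.injective e))
      · exact Set.disjoint_singleton_right.2 (hND _ _ (f j).2)
      · exact Set.disjoint_singleton_left.2 (hND _ _ (f i).2)
      · exact Set.disjoint_singleton.2 fun e =>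
          h (congrArg _ (f.injective (Subtype.ext e)))
    · rintro (i | i) (j | j) h
      · simp at h
      · exact hadj i j
      · obtain ⟨a, ha, b, hb, h⟩ := hadj j i
        exact ⟨b, hb, a, ha, h.symm⟩
      · simp at h
  · obtain ⟨S, rfl⟩ : ∃ S : Finset G.V, (S : Set G.V) = N :=
      ⟨N.toFinite.toFinset, by simp⟩
    rw [Set.ncard_coe_finset] at hp
    let x := fun i => (hconn i).nonempty.some
    have hmem : ∀ i, (x i).1 ∈ ((S : Set G.V)ᶜ) := fun i h => hND i _ h (x i).2
    have hclosed : ∀ i, ∀ a b : ((S : Set G.V)ᶜ : Set G.V),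
        (G.graph.induce ((S : Set G.V)ᶜ)).Reachable a b → a.1 ∈ D i → b.1 ∈ D i := by
      rintro i a b ⟨w⟩ ha
      induction w with
      | nil => exact ha
      | @cons a c b h w ih =>
        refine ih ?_
        by_contra hc
        exact c.2 ((Set.ext_iff.1 (hN i) _).1 ⟨hc, _, ha, h⟩)
    have hinj : Function.Injective fun i =>
        (G.graph.induce ((S : Set G.V)ᶜ)).connectedComponentMk ⟨(x i).1, hmem i⟩ := by
      intro i j h
      by_contra hij
      exact Set.disjoint_left.1 (hdisj i j hij)
        (hclosed i _ _ (SimpleGraph.ConnectedComponent.exact h) (x i).2) (x j).2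
    have h1 := Nat.card_le_card_of_injective _ hinj
    have h2 := card_connectedComponent_le_sepNumber G S hp.le
    omega

/-- The number of components left by a separator is at most exponential in its size. -/
theorem sepNumber_le_two_pow_mul {G : FinGraph.{u}} {p d : ℕ} (hsep : sepNumber G p ≤ d)
    (hG : ¬ IsGraphMinor (completeBipartiteGraph (Fin p) (Fin p)) G.graph) (n : ℕ) :
    sepNumber G n ≤ 2 ^ n * (p + d) := by
  classical
  have := G.finite
  refine sepNumber_le fun S hS => ?_
  let K := (G.graph.induce ((S : Set G.V)ᶜ)).ConnectedComponent
  let D : K → Set G.V := fun c => Subtype.val '' c.supp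
  have hconn : ∀ c, (G.graph.induce (D c)).Connected := by
    intro c
    let f : c.toSimpleGraph →g G.graph.induce (D c) :=
      { toFun := fun v => ⟨v.1.1, v.1, v.2, rfl⟩
        map_rel' := fun h => h }
    refine c.connected_toSimpleGraph.map f ?_
    rintro ⟨_, v, hv, rfl⟩
    exact ⟨⟨v, hv⟩, rfl⟩
  have hdisj : ∀ c c', c ≠ c' → Disjoint (D c) (D c') := by
    intro c c' h
    refine Set.disjoint_left.2 ?_
    rintro _ ⟨a, ha, rfl⟩ ⟨b, hb, e⟩
    obtain rfl := Subtype.ext e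
    exact h (ha.symm.trans hb)
  have hbd : ∀ c, outerBoundary G.graph (D c) ⊆ S := by
    rintro c a ⟨ha, _, ⟨w, hw, rfl⟩, hadj⟩
    by_contra hS
    refine ha ⟨⟨a, hS⟩, ?_, rfl⟩
    have : (G.graph.induce ((S : Set G.V)ᶜ)).Adj w ⟨a, hS⟩ := hadj
    exact (SimpleGraph.ConnectedComponent.sound this.symm.reachable).trans hw
  -- Components are grouped by their boundary, one of at most `2 ^ n` subsets of `S`.
  let β : K → Set S := fun c => {s | s.1 ∈ outerBoundary G.graph (D c)}
  have hfib : ∀ N : Set S, Nat.card {c // β c = N} ≤ p + d := by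
    intro N
    refine card_le_of_outerBoundary_eq hsep hG (fun c : {c // β c = N} => D c.1)
      (fun c => hconn _) (fun c c' h => hdisj _ _ fun e => h (Subtype.ext e))
      (Subtype.val '' N) fun c => ?_
    ext a
    exact ⟨fun h => ⟨⟨a, hbd _ h⟩, (Set.ext_iff.1 c.2 _).1 h, rfl⟩,
      fun ⟨s, hs, e⟩ => e ▸ (Set.ext_iff.1 c.2 _).2 hs⟩
  have hcard : Nat.card K = ∑ N : Set S, Nat.card {c // β c = N} := by
    rw [← Nat.card_sigma]
    exact Nat.card_congr (Equiv.sigmaFiberEquiv β).symm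
  change Nat.card K ≤ _
  rw [hcard]
  refine (Finset.sum_le_card_nsmul _ _ _ fun N _ => hfib N).trans ?_
  rw [smul_eq_mul, Finset.card_univ, Fintype.card_set, Fintype.card_coe]
  exact Nat.mul_le_mul_right _ (Nat.pow_le_pow_right two_pos hS)

/-- A graph with `p` vertices is a minor of `K_{p,p}`. -/
theorem IsGraphMinor.of_completeBipartiteGraph {W : Type v} {V : Type u} [Finite W]
    (H : SimpleGraph W) {G : SimpleGraph V} {p : ℕ} (hp : Nat.card W = p)
    (h : IsGraphMinor (completeBipartiteGraph (Fin p) (Fin p)) G) : IsGraphMinor H G := by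
  obtain ⟨B, hconn, hdisj, hadj⟩ := h
  let e : W ≃ Fin p := Finite.equivFinOfCardEq hp
  -- Contracting a perfect matching of `K_{p,p}` yields a complete graph on `p` vertices.
  refine ⟨fun x => B (Sum.inl (e x)) ∪ B (Sum.inr (e x)), fun x => ?_, fun x y h => ?_,
    fun x y h => ?_⟩
  · obtain ⟨a, ha, b, hb, hab⟩ := hadj (Sum.inl (e x)) (Sum.inr (e x)) (by simp)
    exact SimpleGraph.connected_induce_union (hconn _).preconnected (hconn _).preconnected ha hb hab
  · have h' : e x ≠ e y := e.injective.ne h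
    simp only [Set.disjoint_union_left, Set.disjoint_union_right]
    refine ⟨⟨?_, ?_⟩, ?_, ?_⟩ <;> apply hdisj <;> simp [h']
  · obtain ⟨a, ha, b, hb, hab⟩ := hadj (Sum.inl (e x)) (Sum.inr (e y)) (by simp)
    exact ⟨a, Or.inl ha, b, Or.inr hb, hab⟩

/-! ### Iterated exponentials -/

theorem add_le_expIter (k n : ℕ) : n + k ≤ expIter k n := by
  induction k with
  | zero => exact le_rfl
  | succ k ih =>
    calc n + (k + 1) ≤ expIter k n + 1 := by omega
      _ ≤ 2 ^ expIter k n := Nat.lt_two_pow_self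

/-- To hold for every `n`, even 0, the height has to grow with the factor `k`. -/
theorem two_pow_mul_le_expIter (n k : ℕ) : 2 ^ n * k ≤ expIter (k + 1) n :=
  calc 2 ^ n * k ≤ 2 ^ n * 2 ^ k := Nat.mul_le_mul_left _ Nat.lt_two_pow_self.le
    _ = 2 ^ (n + k) := (pow_add ..).symm
    _ ≤ 2 ^ expIter k n := Nat.pow_le_pow_right two_pos (add_le_expIter k n)

/-- For large `n` the factor is absorbed by the second exponential, so one height serves all
factors. -/
theorem eventually_two_pow_mul_le_expIter_two (k : ℕ) :
    ∀ᶠ n in atTop, 2 ^ n * k ≤ expIter 2 n := by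
  filter_upwards [eventually_ge_atTop (k + 1)] with n hn
  have h : n + k ≤ 2 ^ n := by
    obtain ⟨m, rfl⟩ : ∃ m, n = m + 1 := ⟨n - 1, by omega⟩
    have := Nat.lt_two_pow_self (n := m)
    rw [pow_succ]
    omega
  calc 2 ^ n * k ≤ 2 ^ n * 2 ^ k := Nat.mul_le_mul_left _ Nat.lt_two_pow_self.le
    _ = 2 ^ (n + k) := (pow_add ..).symm
    _ ≤ 2 ^ 2 ^ n := Nat.pow_le_pow_right two_pos h

/-! ### Normal spanning forests -/

/-- The ancestor order of a rooted spanning forest of `G`. -/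
structure ForestOrder {V : Type u} (G : SimpleGraph V) where
  le : V → V → Prop
  refl : ∀ a, le a a
  trans : ∀ {a b c}, le a b → le b c → le a c
  antisymm : ∀ {a b}, le a b → le b a → a = b
  chain : ∀ {a b c}, le a c → le b c → le a b ∨ le b a
  adj : ∀ {a b}, le a b → a ≠ b → (∀ x, le a x → le x b → x = a ∨ x = b) → G.Adj a b

namespace ForestOrder

variable {V : Type u} {G : SimpleGraph V}

/-- The number of comparable pairs. -/
noncomputable def size [Fintype V] (T : ForestOrder G) : ℕ := ∑ b, {a | T.le a b}.ncard

/-- The forest in which every vertex is a root. -/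
def discrete (G : SimpleGraph V) : ForestOrder G where
  le := Eq
  refl _ := rfl
  trans := Eq.trans
  antisymm h _ := h
  chain h h' := Or.inl (h.trans h'.symm)
  adj h h' := absurd h h'

/-- Replace the edge from `u` to its parent by an edge to `v`. -/
def move (T : ForestOrder G) {u v : V} (huv : G.Adj v u) (h : ¬ T.le u v) : ForestOrder G where
  -- In the subtree at `u`, the ancestors above `u` are replaced by those of `v`; nothing changes
  -- elsewhere. No cycle arises because `v` lies outside this subtree.
  le a b := (T.le u b ∧ (T.le u a ∧ T.le a b ∨ T.le a v)) ∨ (¬ T.le u b ∧ T.le a b)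
  refl a := by
    have := T.refl a
    tauto
  trans := by
    rintro a b c (⟨hb, hab⟩ | ⟨hb, hab⟩) (⟨hc, hbc⟩ | ⟨hc, hbc⟩)
    · rcases hbc with ⟨-, hbc⟩ | hbc
      · exact Or.inl ⟨hc, hab.imp_left fun h => ⟨h.1, T.trans h.2 hbc⟩⟩
      · exact absurd (T.trans hb hbc) h
    · exact absurd (T.trans hb hbc) hc
    · rcases hbc with ⟨hb', -⟩ | hbc
      · exact absurd hb' hb
      · exact Or.inl ⟨hc, Or.inr (T.trans hab hbc)⟩
    · exact Or.inr ⟨hc, T.trans hab hbc⟩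
  antisymm := by
    rintro a b (⟨hb, hab⟩ | ⟨hb, hab⟩) (⟨ha, hba⟩ | ⟨ha, hba⟩)
    · rcases hab with ⟨-, hab⟩ | hab
      · rcases hba with ⟨-, hba⟩ | hba
        · exact T.antisymm hab hba
        · exact absurd (T.trans hb hba) h
      · exact absurd (T.trans ha hab) h
    · exact absurd (T.trans hb hba) ha
    · exact absurd (T.trans ha hab) hb
    · exact T.antisymm hab hba
  chain := by
    rintro a b c (⟨hc, hac⟩ | ⟨hc, hac⟩) (⟨hc', hbc⟩ | ⟨hc', hbc⟩)
    · rcases hac with ⟨ha, hac⟩ | hac <;> rcases hbc with ⟨hb, hbc⟩ | hbc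
      · exact (T.chain hac hbc).imp (fun h => Or.inl ⟨hb, Or.inl ⟨ha, h⟩⟩)
          (fun h => Or.inl ⟨ha, Or.inl ⟨hb, h⟩⟩)
      · exact Or.inr (Or.inl ⟨ha, Or.inr hbc⟩)
      · exact Or.inl (Or.inl ⟨hb, Or.inr hac⟩)
      · exact (T.chain hac hbc).imp (fun h' => Or.inr ⟨fun hu => h (T.trans hu hbc), h'⟩)
          (fun h' => Or.inr ⟨fun hu => h (T.trans hu hac), h'⟩)
    · exact absurd hc hc'
    · exact absurd hc' hc
    · exact (T.chain hac hbc).imp (fun h' => Or.inr ⟨fun hu => hc (T.trans hu hbc), h'⟩)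
        (fun h' => Or.inr ⟨fun hu => hc (T.trans hu hac), h'⟩)
  adj := by
    rintro a b (⟨hb, hab⟩ | ⟨hb, hab⟩) hne hcov
    · rcases hab with ⟨ha, hab⟩ | hav
      · refine T.adj hab hne fun x hax hxb => hcov x ?_ ?_
        · exact Or.inl ⟨T.trans ha hax, Or.inl ⟨ha, hax⟩⟩
        · exact Or.inl ⟨hb, Or.inl ⟨T.trans ha hax, hxb⟩⟩
      · have hua : u ≠ a := by
          rintro rfl
          exact h hav
        have hbu : b = u := by
          rcases hcov u (Or.inl ⟨T.refl u, Or.inr hav⟩) (Or.inl ⟨hb, Or.inl ⟨T.refl u, hb⟩⟩)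
            with e | e
          · exact absurd e hua
          · exact e.symm
        subst hbu
        have hva : v = a := by
          rcases hcov v (Or.inr ⟨h, hav⟩) (Or.inl ⟨T.refl _, Or.inr (T.refl v)⟩) with e | e
          · exact e
          · exact absurd (e ▸ T.refl _) h
        exact hva ▸ huv
    · refine T.adj hab hne fun x hax hxb => hcov x ?_ ?_
      · exact Or.inr ⟨fun hx => hb (T.trans hx hxb), hax⟩
      · exact Or.inr ⟨hb, hxb⟩

/-- Every vertex of the moved subtree loses the strict ancestors of `u` and gains `v` with all its
ancestors, which are more since `v` is at least as deep as `u`. -/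
theorem size_lt_size_move [Fintype V] (T : ForestOrder G) {u v : V} (huv : G.Adj v u)
    (h : ¬ T.le u v) (hcard : {a | T.le a u}.ncard ≤ {a | T.le a v}.ncard) :
    T.size < (T.move huv h).size := by
  have key : ∀ b, T.le u b → {a | T.le a b}.ncard < {a | (T.move huv h).le a b}.ncard := by
    intro b hb
    have h1 : {a | T.le a b} ⊆ ({a | T.le a u} \ {u}) ∪ {a | T.le u a ∧ T.le a b} := by
      intro a ha
      rcases T.chain ha hb with h' | h'
      · by_cases e : a = u
        · subst e; exact Or.inr ⟨T.refl _, ha⟩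
        · exact Or.inl ⟨h', e⟩
      · exact Or.inr ⟨h', ha⟩
    have h2 : {a | (T.move huv h).le a b} = {a | T.le a v} ∪ {a | T.le u a ∧ T.le a b} := by
      ext a
      simp only [move, Set.mem_ofPred_eq, Set.mem_union]
      tauto
    have h3 : Disjoint {a | T.le a v} {a | T.le u a ∧ T.le a b} :=
      Set.disjoint_left.2 fun a ha ha' => h (T.trans ha'.1 ha)
    have h4 : ({a | T.le a u} \ {u}).ncard < {a | T.le a u}.ncard :=
      Set.ncard_sdiff_singleton_lt_of_mem (T.refl u)
    rw [h2, Set.ncard_union_eq h3]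
    calc _ ≤ _ := Set.ncard_le_ncard h1
      _ ≤ _ := Set.ncard_union_le _ _
      _ < _ := by omega
  refine Finset.sum_lt_sum (fun b _ => ?_) ⟨u, Finset.mem_univ u, key u (T.refl u)⟩
  by_cases hb : T.le u b
  · exact (key b hb).le
  · refine Set.ncard_le_ncard fun a ha => Or.inr ⟨hb, ha⟩

/-- A forest with the most comparable pairs is normal: given an edge between incomparable vertices,
hanging the shallower end below the other would increase the size. -/
theorem exists_adj_comparable [Finite V] (G : SimpleGraph V) :
    ∃ T : ForestOrder G, ∀ u v, G.Adj u v → T.le u v ∨ T.le v u := by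
  have := Fintype.ofFinite V
  have hbdd : BddAbove (Set.range (size (G := G))) := by
    refine ⟨∑ _b : V, Nat.card V, ?_⟩
    rintro _ ⟨T, rfl⟩
    exact Finset.sum_le_sum fun b _ => Set.ncard_le_card _
  obtain ⟨T, hT⟩ := Nat.sSup_mem ⟨_, Set.mem_range_self (discrete G)⟩ hbdd
  refine ⟨T, fun u v huv => ?_⟩
  by_contra! hn
  have hmax : ∀ T' : ForestOrder G, T'.size ≤ T.size := fun T' =>
    hT.symm ▸ le_csSup hbdd ⟨T', rfl⟩
  rcases le_total {a | T.le a u}.ncard {a | T.le a v}.ncard with h | h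
  · exact (hmax _).not_gt (T.size_lt_size_move huv.symm hn.1 h)
  · exact (hmax _).not_gt (T.size_lt_size_move huv hn.2 h)

end ForestOrder

/-- The order of `V` is the ancestor order of a normal spanning forest of `G`. -/
structure IsNormalForest {V : Type u} [PartialOrder V] (G : SimpleGraph V) : Prop where
  chain : ∀ {a b c : V}, a ≤ c → b ≤ c → a ≤ b ∨ b ≤ a
  adj_of_covBy : ∀ {a b : V}, a ⋖ b → G.Adj a b
  comparable : ∀ {a b : V}, G.Adj a b → a ≤ b ∨ b ≤ a

theorem exists_isNormalForest {V : Type u} [Finite V] (G : SimpleGraph V) :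
    ∃ _ : PartialOrder V, IsNormalForest G := by
  obtain ⟨T, hT⟩ := ForestOrder.exists_adj_comparable G
  let i : PartialOrder V :=
    { le := T.le
      le_refl := T.refl
      le_trans := fun _ _ _ => T.trans
      le_antisymm := fun _ _ => T.antisymm }
  exact ⟨i, T.chain, fun {a b} h => T.adj h.le h.ne fun x hax hxb => h.eq_or_eq hax hxb,
    fun h => hT _ _ h⟩

namespace IsNormalForest

variable {V : Type u} [PartialOrder V] {G : SimpleGraph V}

theorem reflTransGen_covBy [Finite V] {x y : V} (h : x ≤ y) :
    Relation.ReflTransGen (· ⋖ ·) x y := by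
  classical
  have := Fintype.ofFinite V
  let : LocallyFiniteOrder V := Fintype.toLocallyFiniteOrder
  exact le_iff_reflTransGen_covBy.1 h

theorem connected_Ici [Finite V] (h : IsNormalForest G) (x : V) :
    (G.induce (Set.Ici x)).Connected := by
  have hle : ∀ y, Relation.ReflTransGen (· ⋖ ·) x y → x ≤ y := by
    intro y hxy
    induction hxy with
    | refl => exact le_rfl
    | tail _ h ih => exact ih.trans h.le
  have key : ∀ y, Relation.ReflTransGen (· ⋖ ·) x y → ∀ hy : x ≤ y,
      (G.induce (Set.Ici x)).Reachable ⟨x, le_rfl⟩ ⟨y, hy⟩ := by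
    intro y hxy
    induction hxy with
    | refl => exact fun _ => SimpleGraph.Reachable.refl _
    | @tail y z hxy hyz ih =>
      intro hz
      refine (ih (hle y hxy)).trans (SimpleGraph.Adj.reachable ?_)
      exact h.adj_of_covBy hyz
  rw [SimpleGraph.connected_iff_exists_forall_reachable]
  exact ⟨⟨x, le_rfl⟩, fun y => key y.1 (reflTransGen_covBy y.2) y.2⟩

/-- By normality a neighbour of a subtree is comparable to a vertex of it. Thus boundaries of
subtrees are chains, and those of siblings lie in one common chain. -/
theorem outerBoundary_subset (h : IsNormalForest G) (x : V) :
    outerBoundary G (Set.Ici x) ⊆ Set.Iio x := by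
  rintro a ⟨ha, w, hw, hadj⟩
  have haw : a ≤ w := (h.comparable hadj).resolve_left fun h' => ha (le_trans hw h')
  exact lt_of_le_of_ne ((h.chain haw hw).resolve_right ha) fun e => ha e.ge

theorem eq_of_Iio_eq {x y : V} (hxy : Set.Iio x = Set.Iio y)
    (hle : x ≤ y) : x = y := by
  by_contra hne
  exact lt_irrefl x (show x ∈ Set.Iio x from hxy ▸ lt_of_le_of_ne hle hne)

/-- Siblings, meaning vertices with equal sets of strict ancestors and so including roots, have
disjoint subtrees. -/
theorem eq_of_le_of_le (h : IsNormalForest G) {x y z : V} (hxy : Set.Iio x = Set.Iio y)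
    (hx : x ≤ z) (hy : y ≤ z) : x = y := by
  rcases h.chain hx hy with h' | h'
  · exact eq_of_Iio_eq hxy h'
  · exact (eq_of_Iio_eq hxy.symm h').symm

theorem ncard_Iio_of_covBy [Finite V] (h : IsNormalForest G) {x y : V} (hxy : x ⋖ y) :
    (Set.Iio y).ncard = (Set.Iio x).ncard + 1 := by
  have : Set.Iio y = insert x (Set.Iio x) := by
    ext a
    simp only [Set.mem_Iio, Set.mem_insert_iff]
    constructor
    · intro ha
      rcases h.chain ha.le hxy.le with h' | h'
      · exact h'.eq_or_lt
      · exact Or.inl ((hxy.eq_or_eq h' ha.le).resolve_right ha.ne)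
    · rintro (rfl | ha)
      · exact hxy.lt
      · exact ha.trans hxy.lt
  rw [this, Set.ncard_insert_of_notMem (by simp)]

end IsNormalForest

/-- A bounded number of colours distinguishes siblings whose subtrees have the same boundary. -/
theorem exists_sibling_coloring {G : FinGraph.{u}} [PartialOrder G.V]
    (h : IsNormalForest G.graph) {p d : ℕ} (hsep : sepNumber G p ≤ d)
    (hG : ¬ IsGraphMinor (completeBipartiteGraph (Fin p) (Fin p)) G.graph) :
    ∃ c : G.V → Fin (p + d), ∀ x y, Set.Iio x = Set.Iio y →
      outerBoundary G.graph (Set.Ici x) = outerBoundary G.graph (Set.Ici y) → c x = c y →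
      x = y := by
  have := G.finite
  let key : G.V → Set G.V × Set G.V := fun x => (Set.Iio x, outerBoundary G.graph (Set.Ici x))
  have hcard : ∀ κ, Nat.card {x // key x = κ} ≤ p + d := by
    intro κ
    refine card_le_of_outerBoundary_eq hsep hG (fun x : {x // key x = κ} => Set.Ici x.1)
      (fun x => h.connected_Ici x.1) (fun x y hxy => ?_) κ.2 fun x => congrArg Prod.snd x.2
    refine Set.disjoint_left.2 fun z hx hy => hxy (Subtype.ext ?_)
    exact h.eq_of_le_of_le (congrArg Prod.fst (x.2.trans y.2.symm)) hx hy
  have hemb : ∀ κ, Nonempty ({x // key x = κ} ↪ Fin (p + d)) := by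
    intro κ
    have := Fintype.ofFinite {x // key x = κ}
    refine Function.Embedding.nonempty_of_card_le ?_
    rw [Fintype.card_fin, ← Nat.card_eq_fintype_card]
    exact hcard κ
  let e := fun κ => (hemb κ).some
  have hc : ∀ x κ (hx : key x = κ), e (key x) ⟨x, rfl⟩ = e κ ⟨x, hx⟩ := by
    rintro x _ rfl
    rfl
  refine ⟨fun x => e (key x) ⟨x, rfl⟩, fun x y h1 h2 h3 => ?_⟩
  have hk : key x = key y := Prod.ext h1 h2
  exact congrArg Subtype.val ((e (key y)).injective ((hc x _ hk).symm.trans h3))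

/-! ### Linear orders from forest orders -/

/-- The first element at which `X` and `Y` differ belongs to `X`. -/
def FirstDiff {α : Type*} (r : α → α → Prop) (X Y : Set α) : Prop :=
  ∃ a, a ∈ X ∧ a ∉ Y ∧ ∀ b, r b a → b ≠ a → (b ∈ X ↔ b ∈ Y)

namespace FirstDiff

variable {α : Type*} {r : α → α → Prop}

theorem irrefl (X : Set α) : ¬ FirstDiff r X X := fun ⟨_, h, h', _⟩ => h' h

/-- The earlier of the two places of difference decides; comparability is needed only between these
two places. -/
theorem trans [IsPartialOrder α r] {X Y Z : Set α} (hchain : ∀ a ∈ X, ∀ b ∈ Y, r a b ∨ r b a)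
    (h : FirstDiff r X Y) (h' : FirstDiff r Y Z) : FirstDiff r X Z := by
  obtain ⟨a, haX, haY, ha⟩ := h
  obtain ⟨b, hbY, hbZ, hb⟩ := h'
  have hab : a ≠ b := fun e => haY (e ▸ hbY)
  rcases hchain a haX b hbY with h | h
  · refine ⟨a, haX, fun haZ => haY ((hb a h hab).2 haZ), fun c hca hne => ?_⟩
    rw [ha c hca hne, hb c (_root_.trans hca h)]
    rintro rfl
    exact hab (antisymm h hca)
  · refine ⟨b, (ha b h hab.symm).2 hbY, hbZ, fun c hcb hne => ?_⟩
    rw [ha c (_root_.trans hcb h), hb c hcb hne]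
    rintro rfl
    exact hab (antisymm hcb h)

/-- A minimal element of the symmetric difference is a first difference, even in a partial order. -/
theorem trichotomous [IsPartialOrder α r] [Finite α] {X Y : Set α} (hne : X ≠ Y) :
    FirstDiff r X Y ∨ FirstDiff r Y X := by
  let i : PartialOrder α :=
    { le := r
      le_refl := _root_.refl
      le_trans := fun _ _ _ => _root_.trans
      le_antisymm := fun _ _ => _root_.antisymm }
  have hex : {a | ¬ (a ∈ X ↔ a ∈ Y)}.Nonempty := by
    by_contra h
    refine hne (Set.ext fun a => ?_)
    by_contra ha
    exact h ⟨a, ha⟩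
  obtain ⟨a, ha⟩ := (Set.toFinite {a | ¬ (a ∈ X ↔ a ∈ Y)}).exists_minimal hex
  have hmin : ∀ b, r b a → b ≠ a → (b ∈ X ↔ b ∈ Y) := by
    intro b hba hne
    by_contra hb
    exact hne (antisymm hba (ha.2 hb hba))
  by_cases haX : a ∈ X
  · exact Or.inl ⟨a, haX, fun haY => ha.1 (iff_of_true haX haY), hmin⟩
  · exact Or.inr ⟨a, by_contra fun haY => ha.1 (iff_of_false haX haY), haX,
      fun b h h' => (hmin b h h').symm⟩

end FirstDiff

/-- The depth-first order of a forest, given an order `S` of siblings. -/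
def TreeLE {V : Type u} [PartialOrder V] (S : V → V → Prop) (u v : V) : Prop :=
  u ≤ v ∨ ∃ x y, x ≤ u ∧ y ≤ v ∧ Set.Iio x = Set.Iio y ∧ S x y

/-- The branches to two incomparable vertices part at a unique pair of siblings, possibly two roots,
and `S` on that pair decides. For transitivity, the higher of the two branching points is the
relevant one. -/
theorem isLinearOrder_treeLE {V : Type u} [PartialOrder V] [Finite V] {G : SimpleGraph V}
    (h : IsNormalForest G) {S : V → V → Prop} (hirrefl : ∀ x, ¬ S x x)
    (htrans : ∀ x y z, Set.Iio x = Set.Iio y → Set.Iio y = Set.Iio z → S x y → S y z → S x z)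
    (htri : ∀ x y, Set.Iio x = Set.Iio y → x ≠ y → S x y ∨ S y x) :
    IsLinearOrder V (TreeLE S) := by
  let R (u v : V) : Prop := ∃ x y, x ≤ u ∧ y ≤ v ∧ Set.Iio x = Set.Iio y ∧ S x y
  have lt_of : ∀ {x y z : V}, Set.Iio x = Set.Iio y → z < x → z < y := fun e h => by
    rwa [← Set.mem_Iio, ← e]
  have RR : ∀ {u v w}, R u v → R v w → R u w := by
    rintro u v w ⟨x, y, hxu, hyv, hxy, hS⟩ ⟨y', z, hyv', hzw, hyz, hS'⟩
    rcases h.chain hyv hyv' with h1 | h1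
    · rcases h1.eq_or_lt with rfl | h1
      · exact ⟨x, z, hxu, hzw, hxy.trans hyz, htrans _ _ _ hxy hyz hS hS'⟩
      · exact ⟨x, y, hxu, (lt_of hyz h1).le.trans hzw, hxy, hS⟩
    · rcases h1.eq_or_lt with rfl | h1
      · exact ⟨x, z, hxu, hzw, hxy.trans hyz, htrans _ _ _ hxy hyz hS hS'⟩
      · exact ⟨y', z, (lt_of hxy.symm h1).le.trans hxu, hzw, hyz, hS'⟩
  have Rle : ∀ {u v w}, R u v → v ≤ w → R u w := by
    rintro u v w ⟨x, y, hxu, hyv, hxy, hS⟩ hvw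
    exact ⟨x, y, hxu, hyv.trans hvw, hxy, hS⟩
  have leR : ∀ {u v w}, u ≤ v → R v w → u ≤ w ∨ R u w := by
    rintro u v w huv ⟨y, z, hyv, hzw, hyz, hS⟩
    rcases h.chain hyv huv with h1 | h1
    · exact Or.inr ⟨y, z, h1, hzw, hyz, hS⟩
    · rcases h1.eq_or_lt with rfl | h1
      · exact Or.inr ⟨u, z, le_rfl, hzw, hyz, hS⟩
      · exact Or.inl ((lt_of hyz h1).le.trans hzw)
  have irr : ∀ u, ¬ R u u := by
    rintro u ⟨x, y, hx, hy, hxy, hS⟩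
    obtain rfl := h.eq_of_le_of_le hxy hx hy
    exact hirrefl _ hS
  have leR_irr : ∀ {u v}, u ≤ v → ¬ R v u := by
    rintro u v huv hR
    exact irr v (Rle hR huv)
  refine { refl := fun u => Or.inl le_rfl, trans := ?_, antisymm := ?_, total := ?_ }
  · rintro u v w (h1 | h1) (h2 | h2)
    · exact Or.inl (h1.trans h2)
    · exact leR h1 h2
    · exact Or.inr (Rle h1 h2)
    · exact Or.inr (RR h1 h2)
  · rintro u v (h1 | h1) (h2 | h2)
    · exact le_antisymm h1 h2
    · exact absurd h2 (leR_irr h1)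
    · exact absurd h1 (leR_irr h2)
    · exact absurd (RR h1 h2) (irr u)
  · intro u v
    by_cases huv : u ≤ v
    · exact Or.inl (Or.inl huv)
    by_cases hvu : v ≤ u
    · exact Or.inr (Or.inl hvu)
    -- The topmost ancestors of `u` and `v` that are not shared; their strict ancestors are shared,
    -- which makes them siblings.
    obtain ⟨x, hx⟩ := (Set.toFinite {a | a ≤ u ∧ ¬ a ≤ v}).exists_minimal ⟨u, le_rfl, huv⟩
    obtain ⟨y, hy⟩ := (Set.toFinite {a | a ≤ v ∧ ¬ a ≤ u}).exists_minimal ⟨v, le_rfl, hvu⟩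
    have key : ∀ {u v x y : V}, Minimal (· ∈ {a | a ≤ u ∧ ¬ a ≤ v}) x →
        Minimal (· ∈ {a | a ≤ v ∧ ¬ a ≤ u}) y → ∀ a, a < x → a < y := by
      intro u v x y hx hy a ha
      have hau : a ≤ u := ha.le.trans hx.1.1
      have hav : a ≤ v := by
        by_contra hav
        exact ha.not_ge (hx.2 ⟨hau, hav⟩ ha.le)
      rcases h.chain hav hy.1.1 with h1 | h1
      · exact lt_of_le_of_ne h1 fun e => hy.1.2 (e ▸ hau)
      · exact absurd (h1.trans hau) hy.1.2
    have hIio : Set.Iio x = Set.Iio y := Set.ext fun a => ⟨key hx hy a, key hy hx a⟩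
    have hne : x ≠ y := fun e => hx.1.2 (e ▸ hy.1.1)
    rcases htri x y hIio hne with hS | hS
    · exact Or.inl (Or.inr ⟨x, y, hx.1.1, hy.1.1, hIio, hS⟩)
    · exact Or.inr (Or.inr ⟨y, x, hy.1.1, hx.1.1, hIio.symm, hS⟩)

/-- Siblings are compared by the boundaries of their subtrees, then by colour. -/
def SiblingLT {V : Type u} [PartialOrder V] (G : SimpleGraph V) {M : ℕ} (c : V → Fin M)
    (x y : V) : Prop :=
  FirstDiff (· ≤ ·) (outerBoundary G (Set.Ici x)) (outerBoundary G (Set.Ici y)) ∨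
    outerBoundary G (Set.Ici x) = outerBoundary G (Set.Ici y) ∧ c x < c y

theorem isLinearOrder_treeLE_siblingLT {V : Type u} [PartialOrder V] [Finite V]
    {G : SimpleGraph V} (h : IsNormalForest G) {M : ℕ} (c : V → Fin M)
    (hc : ∀ x y, Set.Iio x = Set.Iio y →
      outerBoundary G (Set.Ici x) = outerBoundary G (Set.Ici y) → c x = c y → x = y) :
    IsLinearOrder V (TreeLE (SiblingLT G c)) := by
  refine isLinearOrder_treeLE h ?_ ?_ ?_
  · rintro x (h | h)
    · exact FirstDiff.irrefl _ h
    · exact lt_irrefl _ h.2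
  · rintro x y z hxy hyz (h1 | ⟨h1, h1'⟩) (h2 | ⟨h2, h2'⟩)
    · refine Or.inl (h1.trans (fun a ha b hb => ?_) h2)
      have ha' := h.outerBoundary_subset _ ha
      have hb' := h.outerBoundary_subset _ hb
      rw [← hxy] at hb'
      exact h.chain (le_of_lt ha') (le_of_lt hb')
    · exact Or.inl (h2 ▸ h1)
    · exact Or.inl (h1 ▸ h2)
    · exact Or.inr ⟨h1.trans h2, h1'.trans h2'⟩
  · intro x y hxy hne
    by_cases hb : outerBoundary G (Set.Ici x) = outerBoundary G (Set.Ici y)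
    · exact (lt_or_gt_of_ne fun e => hne (hc x y hxy hb e)).imp (fun h => Or.inr ⟨hb, h⟩)
        (fun h => Or.inr ⟨hb.symm, h⟩)
    · exact (FirstDiff.trichotomous hb).imp Or.inl Or.inl

/-- The order of the incidence structure that extends the order `r` of the vertices: edges come
after vertices, and are compared by the first difference of their sets of ends. -/
def IncLE {V : Type u} (G : SimpleGraph V) (r : V → V → Prop) :
    V ⊕ G.edgeSet → V ⊕ G.edgeSet → Prop
  | .inl u, .inl v => r u v
  | .inl _, .inr _ => True
  | .inr _, .inl _ => False
  | .inr e, .inr f => e = f ∨ FirstDiff r {v | v ∈ e.1} {v | v ∈ f.1}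

theorem isLinearOrder_incLE {V : Type u} [Finite V] (G : SimpleGraph V) {r : V → V → Prop}
    (hr : IsLinearOrder V r) : IsLinearOrder (V ⊕ G.edgeSet) (IncLE G r) := by
  have hchain : ∀ X Y : Set V, ∀ a ∈ X, ∀ b ∈ Y, r a b ∨ r b a := fun _ _ a _ b _ => hr.total a b
  refine { refl := ?_, trans := ?_, antisymm := ?_, total := ?_ }
  · rintro (u | e)
    · exact hr.refl u
    · exact Or.inl rfl
  · rintro (u | e) (v | f) (w | g) h1 h2
    · exact hr.trans _ _ _ h1 h2
    · trivial
    · exact h2.elim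
    · trivial
    · exact h1.elim
    · exact h1.elim
    · exact h2.elim
    · rcases h1 with rfl | h1
      · exact h2
      · rcases h2 with rfl | h2
        · exact Or.inr h1
        · exact Or.inr (h1.trans (hchain _ _) h2)
  · rintro (u | e) (v | f) h1 h2
    · exact congrArg _ (hr.antisymm _ _ h1 h2)
    · exact h2.elim
    · exact h1.elim
    · rcases h1 with rfl | h1
      · rfl
      · rcases h2 with rfl | h2
        · rfl
        · exact absurd (h1.trans (hchain _ _) h2) (FirstDiff.irrefl _)
  · rintro (u | e) (v | f)
    · exact hr.total u v
    · exact Or.inl trivial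
    · exact Or.inr trivial
    · by_cases hef : e = f
      · exact Or.inl (Or.inl hef)
      · have : {v | v ∈ e.1} ≠ {v | v ∈ f.1} := fun h =>
          hef (Subtype.ext (Sym2.ext fun v => Set.ext_iff.1 h v))
        exact (FirstDiff.trichotomous this).imp Or.inr Or.inr

/-! ### Formulas -/

namespace MSOFormula

section

variable {L : FirstOrder.Language.{u, v}} {n m : ℕ}

def neg (φ : MSOFormula L n m) : MSOFormula L n m := imp φ falsum

def and (φ ψ : MSOFormula L n m) : MSOFormula L n m := neg (imp φ (neg ψ))

def or (φ ψ : MSOFormula L n m) : MSOFormula L n m := imp (neg φ) ψ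

def iff (φ ψ : MSOFormula L n m) : MSOFormula L n m := and (imp φ ψ) (imp ψ φ)

def ex (φ : MSOFormula L (n + 1) m) : MSOFormula L n m := neg (all (neg φ))

/-- The disjunction of a finite family of formulas. -/
def orFin : {k : ℕ} → (Fin k → MSOFormula L n m) → MSOFormula L n m
  | 0, _ => falsum
  | _ + 1, φ => or (φ 0) (orFin fun i => φ i.succ)

variable {A : Type w} [L.Structure A] {a : Fin n → A} {P : Fin m → Set A}

@[simp] theorem realize_falsum : (falsum : MSOFormula L n m).Realize a P ↔ False := Iff.rfl

@[simp] theorem realize_eq {i j : Fin n} : (eq i j : MSOFormula L n m).Realize a P ↔ a i = a j :=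
  Iff.rfl

@[simp] theorem realize_mem {i : Fin n} {X : Fin m} :
    (mem i X : MSOFormula L n m).Realize a P ↔ a i ∈ P X :=
  Iff.rfl

@[simp] theorem realize_imp {φ ψ : MSOFormula L n m} :
    (imp φ ψ).Realize a P ↔ (φ.Realize a P → ψ.Realize a P) :=
  Iff.rfl

@[simp] theorem realize_all {φ : MSOFormula L (n + 1) m} :
    φ.all.Realize a P ↔ ∀ b, φ.Realize (Fin.snoc a b) P :=
  Iff.rfl

@[simp] theorem realize_allSet {φ : MSOFormula L n (m + 1)} :
    φ.allSet.Realize a P ↔ ∀ Q, φ.Realize a (Fin.snoc P Q) :=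
  Iff.rfl

@[simp] theorem realize_neg {φ : MSOFormula L n m} : φ.neg.Realize a P ↔ ¬ φ.Realize a P :=
  Iff.rfl

@[simp] theorem realize_and {φ ψ : MSOFormula L n m} :
    (φ.and ψ).Realize a P ↔ φ.Realize a P ∧ ψ.Realize a P := by
  simp [and]

@[simp] theorem realize_or {φ ψ : MSOFormula L n m} :
    (φ.or ψ).Realize a P ↔ φ.Realize a P ∨ ψ.Realize a P := by
  simp [or, or_iff_not_imp_left]

@[simp] theorem realize_iff {φ ψ : MSOFormula L n m} :
    (φ.iff ψ).Realize a P ↔ (φ.Realize a P ↔ ψ.Realize a P) := by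
  simp [iff, iff_def]

@[simp] theorem realize_ex {φ : MSOFormula L (n + 1) m} :
    φ.ex.Realize a P ↔ ∃ b, φ.Realize (Fin.snoc a b) P := by
  simp [ex]

@[simp] theorem realize_orFin {k : ℕ} {φ : Fin k → MSOFormula L n m} :
    (orFin φ).Realize a P ↔ ∃ i, (φ i).Realize a P := by
  induction k with
  | zero => simp [orFin]
  | succ k ih => simp [orFin, ih, Fin.exists_fin_succ]

end

/-! #### Formulas over incidence structures -/

instance instIncStructure {V : Type u} (G : SimpleGraph V) :
    incLanguage.Structure (V ⊕ G.edgeSet) :=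
  incStructure G

/-- A relation of vertices as a relation on the incidence structure. -/
def OnVertices {V : Type u} {E : Type w} (r : V → V → Prop) (x y : V ⊕ E) : Prop :=
  ∃ u v, x = .inl u ∧ y = .inl v ∧ r u v

@[simp] theorem onVertices_inl {V : Type u} {E : Type w} {r : V → V → Prop} {u v : V} :
    OnVertices r (Sum.inl u : V ⊕ E) (Sum.inl v) ↔ r u v := by
  simp [OnVertices]

@[simp] theorem not_onVertices_inr_left {V : Type u} {E : Type w} {r : V → V → Prop} {e : E}
    {y : V ⊕ E} : ¬ OnVertices r (Sum.inr e) y := by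
  simp [OnVertices]

@[simp] theorem not_onVertices_inr_right {V : Type u} {E : Type w} {r : V → V → Prop} {e : E}
    {x : V ⊕ E} : ¬ OnVertices r x (Sum.inr e) := by
  simp [OnVertices]

section

variable {n m : ℕ}

def inc (i j : Fin n) : MSOFormula incLanguage n m := rel IncRel.inc ![i, j]

/-- Every edge has an end, so edges are definable from incidence, and vertices are the remaining
elements. -/
def isEdge (i : Fin n) : MSOFormula incLanguage n m := ex (inc (Fin.last n) i.castSucc)

/-- Quantification over all vertices. -/
def allV (φ : MSOFormula incLanguage (n + 1) m) : MSOFormula incLanguage n m :=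
  all (or (isEdge (Fin.last n)) φ)

/-- Quantification over some vertex. -/
def exV (φ : MSOFormula incLanguage (n + 1) m) : MSOFormula incLanguage n m :=
  neg (allV (neg φ))

def areVertices (i j : Fin n) : MSOFormula incLanguage n m :=
  and (neg (isEdge i)) (neg (isEdge j))

def adj (i j : Fin n) : MSOFormula incLanguage n m :=
  and (neg (eq i j)) (ex (and (inc i.castSucc (Fin.last n)) (inc j.castSucc (Fin.last n))))

/-- `i` and `j` are joined by an edge in `F`, and the index of the set `D` containing `j` is the
successor modulo 3 of that for `i`. -/
def parent (F : Fin m) (D : Fin 3 → Fin m) (i j : Fin n) : MSOFormula incLanguage n m :=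
  and (areVertices i j) (and (orFin fun t => and (mem i (D t)) (mem j (D (t + 1))))
    (ex (and (mem (Fin.last n) F)
      (and (inc i.castSucc (Fin.last n)) (inc j.castSucc (Fin.last n))))))

/-- Every set containing `j` and closed under parents contains `i`. -/
def anc (F : Fin m) (D : Fin 3 → Fin m) (i j : Fin n) : MSOFormula incLanguage n m :=
  and (areVertices i j) (allSet (imp (mem j (Fin.last m))
    (imp (allV (allV (imp (parent F.castSucc (fun t => (D t).castSucc)
      (Fin.last n).castSucc (Fin.last (n + 1)))
      (imp (mem (Fin.last (n + 1)) (Fin.last m)) (mem (Fin.last n).castSucc (Fin.last m))))))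
    (mem i (Fin.last m)))))

variable {V : Type u} {G : SimpleGraph V} {a : Fin n → V ⊕ G.edgeSet}
  {P : Fin m → Set (V ⊕ G.edgeSet)}

@[simp] theorem realize_inc {i j : Fin n} : (inc i j : MSOFormula incLanguage n m).Realize a P ↔
    ∃ (v : V) (e : G.edgeSet), a i = Sum.inl v ∧ a j = Sum.inr e ∧ v ∈ e.1 :=
  Iff.rfl

@[simp] theorem realize_isEdge {i : Fin n} :
    (isEdge i : MSOFormula incLanguage n m).Realize a P ↔ ∃ e, a i = Sum.inr e := by
  simp only [isEdge, realize_ex, realize_inc, Fin.snoc_last, Fin.snoc_castSucc]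
  constructor
  · rintro ⟨_, v, e, -, h, -⟩
    exact ⟨e, h⟩
  · rintro ⟨e, h⟩
    exact ⟨_, _, e, rfl, h, Sym2.out_fst_mem e.1⟩

@[simp] theorem realize_allV {φ : MSOFormula incLanguage (n + 1) m} :
    φ.allV.Realize a P ↔ ∀ v : V, φ.Realize (Fin.snoc a (Sum.inl v)) P := by
  simp [allV]

@[simp] theorem realize_exV {φ : MSOFormula incLanguage (n + 1) m} :
    φ.exV.Realize a P ↔ ∃ v : V, φ.Realize (Fin.snoc a (Sum.inl v)) P := by
  simp [exV]

@[simp] theorem realize_areVertices {i j : Fin n} :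
    (areVertices i j : MSOFormula incLanguage n m).Realize a P ↔
      OnVertices (fun _ _ => True) (a i) (a j) := by
  cases hi : a i <;> cases hj : a j <;> simp [areVertices, hi, hj]

@[simp] theorem realize_adj {i j : Fin n} :
    (adj i j : MSOFormula incLanguage n m).Realize a P ↔ OnVertices G.Adj (a i) (a j) := by
  cases hi : a i with
  | inr => simp [adj, hi]
  | inl u =>
    cases hj : a j with
    | inr => simp [adj, hj]
    | inl v =>
      simp only [adj, realize_and, realize_neg, realize_eq, realize_ex, realize_inc, hi, hj,
        Fin.snoc_last, Fin.snoc_castSucc, onVertices_inl]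
      constructor
      · rintro ⟨hne, _, ⟨_, e, h1, rfl, hu⟩, _, _, h2, h3, hv⟩
        cases h1; cases h2; cases h3
        exact adj_of_mem_incEnds (x := Sum.inr e) hu hv fun h => hne (congrArg _ h)
      · intro h
        exact ⟨fun e => h.ne (Sum.inl.inj e), Sum.inr ⟨s(u, v), h⟩,
          ⟨u, _, rfl, rfl, Sym2.mem_mk_left _ _⟩, v, _, rfl, rfl, Sym2.mem_mk_right _ _⟩

/-- Depth increases by one along a forest edge, and 1 and -1 differ modulo 3, so the depth classes
orient the edges of the forest. -/
theorem realize_parent [PartialOrder V] [Finite V] (hG : IsNormalForest G) {F : Fin m}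
    {D : Fin 3 → Fin m}
    (hF : P F = {x | ∃ e, x = Sum.inr e ∧ ∃ u v : V, u ⋖ v ∧ e.1 = s(u, v)})
    (hD : ∀ t, P (D t) = {x | ∃ v, x = Sum.inl v ∧ ((Set.Iio v).ncard : ZMod 3) = t})
    {i j : Fin n} :
    (parent F D i j).Realize a P ↔ OnVertices (· ⋖ ·) (a i) (a j) := by
  cases hi : a i with
  | inr => simp [parent, hi]
  | inl u =>
    cases hj : a j with
    | inr => simp [parent, hj]
    | inl v =>
      simp only [parent, realize_and, realize_areVertices, realize_orFin, realize_mem, hi, hj,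
        realize_ex, realize_inc, Fin.snoc_last, Fin.snoc_castSucc, onVertices_inl, true_and, hF,
        hD]
      constructor
      · have mod_three : ∀ t : ZMod 3, ¬ t + 1 = t := by decide
        have mod_three' : ∀ t : ZMod 3, ¬ t + 1 + 1 = t := by decide
        rintro ⟨⟨t, ⟨_, h, ht⟩, _, h', ht'⟩, _, ⟨e, rfl, x, y, hxy, he⟩, ⟨_, e1, h1, h2, hu⟩,
          _, e2, h3, h4, hv⟩
        cases h; cases h'; cases h1; cases h2; cases h3; cases h4
        rw [he, Sym2.mem_iff] at hu hv
        have hne : ¬ ((Set.Iio v).ncard : ZMod 3) = (Set.Iio u).ncard := by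
          rw [ht, ht']
          exact mod_three t
        rcases hu with rfl | rfl <;> rcases hv with rfl | rfl
        · exact absurd rfl hne
        · exact hxy
        · exfalso
          rw [hG.ncard_Iio_of_covBy hxy] at ht
          push_cast at ht
          rw [ht'] at ht
          exact mod_three' t ht
        · exact absurd rfl hne
      · intro h
        refine ⟨⟨((Set.Iio u).ncard : ZMod 3), ⟨u, rfl, rfl⟩, v, rfl, ?_⟩, _,
          ⟨⟨s(u, v), hG.adj_of_covBy h⟩, rfl, u, v, h, rfl⟩,
          ⟨u, _, rfl, rfl, Sym2.mem_mk_left _ _⟩, v, _, rfl, rfl, Sym2.mem_mk_right _ _⟩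
        rw [hG.ncard_Iio_of_covBy h]
        push_cast
        rfl

/-- In a finite order `≤` is the reflexive transitive closure of covering, which a set quantifier
expresses. The test set in one direction is the set of ancestors of `v`. -/
theorem realize_anc [PartialOrder V] [Finite V] (hG : IsNormalForest G) {F : Fin m}
    {D : Fin 3 → Fin m}
    (hF : P F = {x | ∃ e, x = Sum.inr e ∧ ∃ u v : V, u ⋖ v ∧ e.1 = s(u, v)})
    (hD : ∀ t, P (D t) = {x | ∃ v, x = Sum.inl v ∧ ((Set.Iio v).ncard : ZMod 3) = t})
    {i j : Fin n} :
    (anc F D i j).Realize a P ↔ OnVertices (· ≤ ·) (a i) (a j) := by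
  cases hi : a i with
  | inr => simp [anc, hi]
  | inl u =>
    cases hj : a j with
    | inr => simp [anc, hj]
    | inl v =>
      simp only [anc, realize_and, realize_areVertices, hi, hj, onVertices_inl, true_and,
        realize_allSet, realize_imp, realize_mem, Fin.snoc_last, realize_allV, Fin.snoc_castSucc]
      have hp : ∀ (Q : Set (V ⊕ G.edgeSet)) (x y : V),
          (parent F.castSucc (fun t => (D t).castSucc) (Fin.last n).castSucc
            (Fin.last (n + 1))).Realize
            (Fin.snoc (Fin.snoc a (Sum.inl x) : Fin (n + 1) → V ⊕ G.edgeSet) (Sum.inl y) :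
              Fin (n + 2) → V ⊕ G.edgeSet)
            (Fin.snoc P Q : Fin (m + 1) → Set (V ⊕ G.edgeSet)) ↔ x ⋖ y := by
        intro Q x y
        rw [realize_parent hG (by simpa using hF) (by simpa using hD)]
        simp
      simp only [hp]
      constructor
      · intro H
        have := H {x | ∃ w, x = Sum.inl w ∧ w ≤ v} ⟨v, rfl, le_rfl⟩ ?_
        · obtain ⟨w, hw, hwv⟩ := this
          exact Sum.inl.inj hw ▸ hwv
        · rintro x y hxy ⟨w, hw, hwv⟩
          exact ⟨x, rfl, hxy.le.trans (Sum.inl.inj hw ▸ hwv)⟩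
      · intro huv Q hv hQ
        have h := IsNormalForest.reflTransGen_covBy huv
        clear huv hi
        induction h using Relation.ReflTransGen.head_induction_on with
        | refl => exact hv
        | head h _ ih => exact hQ _ _ h ih

end

/-! #### The formula defining the order -/

section

variable (M : ℕ) {n : ℕ}

/-- The index of the parameter for the edges of the forest. -/
def forestParam : Fin (4 + M) := finSumFinEquiv (Sum.inl 0)

/-- The indices of the parameters for the depth modulo 3. -/
def depthParam (t : Fin 3) : Fin (4 + M) := finSumFinEquiv (Sum.inl t.succ)

/-- The indices of the parameters for the colours. -/
def colorParam (t : Fin M) : Fin (4 + M) := finSumFinEquiv (Sum.inr t)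

def le (i j : Fin n) : MSOFormula incLanguage n (4 + M) := anc (forestParam M) (depthParam M) i j

def lt (i j : Fin n) : MSOFormula incLanguage n (4 + M) := and (le M i j) (neg (eq i j))

/-- `i` belongs to the boundary of the subtree at `j`. -/
def boundary (i j : Fin n) : MSOFormula incLanguage n (4 + M) :=
  and (areVertices i j) (and (neg (le M j i))
    (exV (and (le M j.castSucc (Fin.last n)) (adj (Fin.last n) i.castSucc))))

/-- `i` and `j` have the same strict ancestors. -/
def sibling (i j : Fin n) : MSOFormula incLanguage n (4 + M) :=
  and (areVertices i j) (allV (iff (lt M (Fin.last n) i.castSucc) (lt M (Fin.last n) j.castSucc)))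

def colorLT (i j : Fin n) : MSOFormula incLanguage n (4 + M) :=
  and (areVertices i j)
    (orFin fun t => and (neg (mem i (colorParam M t))) (mem j (colorParam M t)))

/-- The first difference of two sets of vertices, with respect to an order of the vertices. -/
def firstDiff {m : ℕ} (r : ∀ {n : ℕ}, Fin n → Fin n → MSOFormula incLanguage n m)
    (b : ∀ {n : ℕ}, Fin n → Fin n → MSOFormula incLanguage n m) (i j : Fin n) :
    MSOFormula incLanguage n m :=
  exV (and (b (Fin.last n) i.castSucc) (and (neg (b (Fin.last n) j.castSucc))
    (allV (imp (r (Fin.last (n + 1)) (Fin.last n).castSucc)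
      (imp (neg (eq (Fin.last (n + 1)) (Fin.last n).castSucc))
        (iff (b (Fin.last (n + 1)) i.castSucc.castSucc)
          (b (Fin.last (n + 1)) j.castSucc.castSucc)))))))

def siblingLT (i j : Fin n) : MSOFormula incLanguage n (4 + M) :=
  and (areVertices i j) (or (firstDiff (le M) (boundary M) i j)
    (and (allV (iff (boundary M (Fin.last n) i.castSucc) (boundary M (Fin.last n) j.castSucc)))
      (colorLT M i j)))

def treeLE (i j : Fin n) : MSOFormula incLanguage n (4 + M) :=
  or (le M i j) (and (areVertices i j) (exV (exV
    (and (le M (Fin.last n).castSucc i.castSucc.castSucc)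
      (and (le M (Fin.last (n + 1)) j.castSucc.castSucc)
        (and (sibling M (Fin.last n).castSucc (Fin.last (n + 1)))
          (siblingLT M (Fin.last n).castSucc (Fin.last (n + 1)))))))))

def incLE (i j : Fin n) : MSOFormula incLanguage n (4 + M) :=
  or (treeLE M i j) (and (isEdge j)
    (or (neg (isEdge i)) (or (eq i j) (firstDiff (treeLE M) inc i j))))

theorem realize_firstDiff_inc {V : Type u} {G : SimpleGraph V} {m : ℕ} {P : Fin m → Set (V ⊕ G.edgeSet)}
    {r : ∀ {n : ℕ}, Fin n → Fin n → MSOFormula incLanguage n m} {r' : V → V → Prop}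
    (hr : ∀ {n : ℕ} (i j : Fin n) (a : Fin n → V ⊕ G.edgeSet),
      (r i j).Realize a P ↔ OnVertices r' (a i) (a j))
    {a : Fin n → V ⊕ G.edgeSet} {i j : Fin n} {e f : G.edgeSet} (hi : a i = Sum.inr e) (hj : a j = Sum.inr f) :
    (firstDiff r inc i j).Realize a P ↔ FirstDiff r' {v | v ∈ e.1} {v | v ∈ f.1} := by
  simp [firstDiff, FirstDiff, hr, hi, hj]

variable {M} {V : Type u} [PartialOrder V] {G : SimpleGraph V}

variable (G) in
/-- The values of the parameters for a coloured forest. -/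
noncomputable def params (c : V → Fin M) (t : Fin (4 + M)) : Set (V ⊕ G.edgeSet) :=
  Sum.elim
    (Fin.cases {x | ∃ e, x = Sum.inr e ∧ ∃ u v : V, u ⋖ v ∧ e.1 = s(u, v)}
      (fun t : Fin 3 => {x | ∃ v, x = Sum.inl v ∧ ((Set.Iio v).ncard : ZMod 3) = t}))
    -- Threshold sets instead of colour classes: `c u < c v` holds exactly if some threshold set
    -- contains `v` but not `u`.
    (fun t : Fin M => {x | ∃ v, x = Sum.inl v ∧ t ≤ c v})
    (finSumFinEquiv.symm t)

variable {c : V → Fin M} {a : Fin n → V ⊕ G.edgeSet}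

@[simp] theorem realize_colorLT {i j : Fin n} : (colorLT M i j).Realize a (params G c) ↔
    OnVertices (fun u v => c u < c v) (a i) (a j) := by
  cases hi : a i with
  | inr => simp [colorLT, hi]
  | inl u =>
    cases hj : a j with
    | inr => simp [colorLT, hj]
    | inl v =>
      simp only [colorLT, realize_and, realize_areVertices, hi, hj, onVertices_inl, true_and,
        realize_orFin, realize_neg, realize_mem, params, colorParam, Equiv.symm_apply_apply,
        Sum.elim_inr]
      constructor
      · rintro ⟨t, h, _, h', ht⟩
        cases h'
        exact lt_of_not_ge fun h' => h ⟨u, rfl, ht.trans h'⟩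
      · intro h
        refine ⟨c v, ?_, v, rfl, le_rfl⟩
        rintro ⟨_, h', ht⟩
        cases h'
        exact ht.not_gt h

variable [Finite V]

theorem realize_le (hG : IsNormalForest G) {i j : Fin n} : (le M i j).Realize a (params G c) ↔
    OnVertices (· ≤ ·) (a i) (a j) :=
  realize_anc hG (by simp [params, forestParam]) (by simp [params, depthParam])

theorem realize_lt (hG : IsNormalForest G) {i j : Fin n} : (lt M i j).Realize a (params G c) ↔
    OnVertices (· < ·) (a i) (a j) := by
  cases hi : a i <;> cases hj : a j <;> simp [lt, realize_le hG, hi, hj, lt_iff_le_and_ne]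

theorem realize_boundary (hG : IsNormalForest G) {i j : Fin n} : (boundary M i j).Realize a (params G c) ↔
    OnVertices (fun u v => u ∈ outerBoundary G (Set.Ici v)) (a i) (a j) := by
  cases hi : a i <;> cases hj : a j <;> simp [boundary, realize_le hG, hi, hj, outerBoundary]

theorem realize_sibling (hG : IsNormalForest G) {i j : Fin n} : (sibling M i j).Realize a (params G c) ↔
    OnVertices (fun u v => Set.Iio u = Set.Iio v) (a i) (a j) := by
  cases hi : a i <;> cases hj : a j <;> simp [sibling, realize_lt hG, hi, hj, Set.ext_iff]

theorem realize_siblingLT (hG : IsNormalForest G) {i j : Fin n} : (siblingLT M i j).Realize a (params G c) ↔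
    OnVertices (SiblingLT G c) (a i) (a j) := by
  cases hi : a i <;> cases hj : a j <;>
    simp [siblingLT, firstDiff, realize_le hG, realize_boundary hG, hi, hj, SiblingLT, FirstDiff,
      Set.ext_iff]

theorem realize_treeLE (hG : IsNormalForest G) {i j : Fin n} : (treeLE M i j).Realize a (params G c) ↔
    OnVertices (TreeLE (SiblingLT G c)) (a i) (a j) := by
  cases hi : a i <;> cases hj : a j <;>
    simp [treeLE, realize_le hG, realize_sibling hG, realize_siblingLT hG, hi, hj, TreeLE]

theorem realize_incLE (hG : IsNormalForest G) {i j : Fin n} : (incLE M i j).Realize a (params G c) ↔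
    IncLE G (TreeLE (SiblingLT G c)) (a i) (a j) := by
  cases hi : a i with
  | inl u => cases hj : a j <;> simp [incLE, realize_treeLE hG, hi, hj, IncLE]
  | inr e =>
    cases hj : a j with
    | inl v => simp [incLE, realize_treeLE hG, hi, hj, IncLE]
    | inr f =>
      simp [incLE, realize_treeLE hG, IncLE, hi, hj,
        realize_firstDiff_inc (fun i j a => realize_treeLE hG (c := c) (i := i) (j := j)) hi hj]

end

end MSOFormula

/-- Graphs without `K_{p,p}` minor and with bounded `Sep(G, p)` are MSO₂-orderable. -/
theorem mso2Orderable_of_sepNumber_le {C : Set FinGraph.{u}} {p d : ℕ}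
    (h : ∀ G ∈ C, sepNumber G p ≤ d ∧
      ¬ IsGraphMinor (completeBipartiteGraph (Fin p) (Fin p)) G.graph) : MSO2Orderable C := by
  -- The parameters are the forest edges, three depth classes and `p + d` colour thresholds.
  refine ⟨4 + (p + d), MSOFormula.incLE (p + d) 0 1, ?_⟩
  rintro _ ⟨G, hG, rfl⟩ -
  have := G.finite
  obtain ⟨_, hF⟩ := exists_isNormalForest G.graph
  obtain ⟨c, hc⟩ := exists_sibling_coloring hF (h G hG).1 (h G hG).2
  refine ⟨MSOFormula.params G.graph c, ?_⟩
  have hlin := isLinearOrder_incLE G.graph (isLinearOrder_treeLE_siblingLT hF c hc)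
  convert hlin using 1
  funext x y
  exact propext (MSOFormula.realize_incLE hF)

/-! ### Classes omitting a minor, and the main theorem. -/

theorem OmitsMinor.not_isGraphMinor_completeBipartiteGraph {W : Type v} [Finite W]
    {H : SimpleGraph W} {C : Set FinGraph.{u}} (h : OmitsMinor C H) {G : FinGraph.{u}}
    (hG : G ∈ C) :
    ¬ IsGraphMinor (completeBipartiteGraph (Fin (Nat.card W)) (Fin (Nat.card W))) G.graph :=
  fun h' => h G hG (h'.of_completeBipartiteGraph H rfl)

/-- Only the value of the SEP bound at `|V(H)|` is needed to construct the order. -/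
theorem OmitsMinor.mso2Orderable_iff_sep {W : Type v} [Finite W] {H : SimpleGraph W}
    {C : Set FinGraph.{u}} (h : OmitsMinor C H) : MSO2Orderable C ↔ SEP C :=
  ⟨MSO2Orderable.sep, fun ⟨_, hf⟩ => mso2Orderable_of_sepNumber_le fun G hG =>
    ⟨hf G hG (Nat.card W), h.not_isGraphMinor_completeBipartiteGraph hG⟩⟩

theorem OmitsMinor.sepBound {W : Type v} [Finite W] {H : SimpleGraph W}
    {C : Set FinGraph.{u}} (h : OmitsMinor C H) {d : ℕ}
    (hd : ∀ G ∈ C, sepNumber G (Nat.card W) ≤ d) :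
    SEPBound (fun n => 2 ^ n * (Nat.card W + d)) C :=
  fun G hG n =>
    sepNumber_le_two_pow_mul (hd G hG) (h.not_isGraphMinor_completeBipartiteGraph hG) n

theorem mainTheorem1 :
    -- the three conditions are equivalent
    (∀ (W : Type v) [Finite W] (H : SimpleGraph W) (C : Set FinGraph.{u}), OmitsMinor C H →
      List.TFAE [
        MSO2Orderable C,
        SEP C,
        ∃ f : ℕ → ℕ, IsElementary f ∧ SEPBound f C]) ∧
    -- a height `k`, computable from `H` alone, such that `exp_k` suffices for large arguments
    (∃ k : GraphCode → ℕ, Computable k ∧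
      ∀ (c : GraphCode) (W : Type v) [Finite W] (H : SimpleGraph W), Nonempty (H ≃g c.toGraph) →
        ∀ C : Set FinGraph.{u}, OmitsMinor C H →
          (MSO2Orderable C ↔
            ∃ f : ℕ → ℕ, (∀ᶠ n in atTop, f n ≤ expIter (k c) n) ∧ SEPBound f C)) ∧
    -- a height `k`, computable from `H` and a bound `d`, such that `exp_k` suffices everywhere
    (∃ k : GraphCode × ℕ → ℕ, Computable k ∧
      ∀ (c : GraphCode) (d : ℕ) (W : Type v) [Finite W] (H : SimpleGraph W),
        Nonempty (H ≃g c.toGraph) →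
        ∀ C : Set FinGraph.{u}, OmitsMinor C H → (∀ G ∈ C, sepNumber G (Nat.card W) ≤ d) →
          SEPBound (expIter (k (c, d))) C) ∧
    -- the classes of graphs without `K_{p,p}` minor and with bounded `Sep(G, p)` are orderable
    (∀ p d : ℕ, MSO2Orderable {G : FinGraph.{u} | sepNumber G p ≤ d ∧
      ¬ IsGraphMinor (completeBipartiteGraph (Fin p) (Fin p)) G.graph}) := by
  -- Height 2 suffices eventually, whatever `H` is. A bound at all arguments uses the height `|V(H)|
  -- + d + 1`, which absorbs the factor `|V(H)| + d`.
  refine ⟨fun W _ H C hC => ?_, ⟨fun _ => 2, Computable.const 2, ?_⟩,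
    ⟨fun x => x.1.1 + x.2 + 1, ?_, ?_⟩, fun p d => mso2Orderable_of_sepNumber_le fun G hG => hG⟩
  · tfae_have 1 ↔ 2 := hC.mso2Orderable_iff_sep
    tfae_have 2 → 3 := fun ⟨f, hf⟩ =>
      ⟨_, ⟨_, fun n => two_pow_mul_le_expIter n _⟩, hC.sepBound fun G hG => hf G hG _⟩
    tfae_have 3 → 2 := fun ⟨f, _, hf⟩ => ⟨f, hf⟩
    tfae_finish
  · intro c W _ H _ C hC
    rw [hC.mso2Orderable_iff_sep]
    exact ⟨fun ⟨f, hf⟩ => ⟨_, eventually_two_pow_mul_le_expIter_two _,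
      hC.sepBound fun G hG => hf G hG _⟩, fun ⟨f, _, hf⟩ => ⟨f, hf⟩⟩
  · have h : Primrec fun x : GraphCode × ℕ => x.1.1 + x.2 + 1 :=
      Primrec.succ.comp (Primrec.nat_add.comp (Primrec.fst.comp Primrec.fst) Primrec.snd)
    exact h.to_comp
  · rintro c d W _ H ⟨e⟩ C hC hd G hG n
    have hW : Nat.card W = c.1 := by rw [Nat.card_congr e.toEquiv, Nat.card_fin]
    refine (hC.sepBound hd G hG n).trans ?_
    rw [hW]
    exact two_pow_mul_le_expIter n (c.1 + d)
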